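/- Let $G\subseteq \mathrm{GL}_n(\mathbb{C})$ be a linear algebraic group (a Zariski closed subgroup; connectedness is not needed), with Lie algebra $\mathfrak{g}\subseteq \mathfrak{gl}_n(\mathbb{C})$. Let $0<a_0<a$, $Q_a=\{z\in\mathbb{C} : |z|<a\}$ and $Q_a^*=Q_a\setminus\{0\}$. Let $\mathcal{E}$ be a holomorphic principal $G$-bundle (with right action) on $Q_a$, and let $\nabla$ be a holomorphic connection on $\mathcal{E}$ with at most a logarithmic pole at $0$. With respect to a local holomorphic section $\sigma$ of $\mathcal{E}$ over $U\subseteq Q_a$, $\nabla$ is given by a form $A_\sigma=v_\sigma(z)\,\frac{dz}{z}$ with $v_\sigma:U\to\mathfrak{g}$ holomorphic, and $A_{\sigma g}=g^{-1}dg+g^{-1}A_\sigma g$ for holomorphic $g:U\to G$; a section is flat if its form vanishes (so $\sigma h$ is flat if and only if $dh=-A_\sigma h$). The residue at $0$ with respect to a point $e_0=\sigma(0)g_0$ of the fibre $\mathcal{E}|_0$ (that is, to an identification $G\cong\mathcal{E}|_0$) is $C=g_0^{-1}v_\sigma(0)g_0\in\mathfrak{g}$. The local monodromy around $0$, with respect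 to a point $e_1$ of the fibre $\mathcal{E}|_{a_0}$, is the element $M\in G$ such that analytic continuation of flat sections of $\mathcal{E}|_{Q_a^*}$ along the circle $t\mapsto a_0e^{2\pi\sqrt{-1}\,t}$ ($0\le t\le 1$) carries $e_1$ to $e_1M$. An element $C\in\mathfrak{g}$ has weakly prepared eigenvalues if there are $N>0$ and an injective morphism of algebraic groups $\iota:G\hookrightarrow\mathrm{GL}_N$ such that distinct eigenvalues of $d\iota(C)$ do not differ by integers; it has prepared eigenvalues if $\iota$ can be chosen such that, in addition, no non-zero integer is an eigenvalue of $d\iota(C)$. Suppose that the residue $C$ of $\nabla$ at $0$ with respect to some $e_0\in\mathcal{E}|_0$ has weakly prepared eigenvalues, and let $e_1\in\mathcal{E}|_{a_0}$. Then the local monodromy $M$ with respect to $e_1$ exists, is uniquely determined, and is conjugate in $G$ to $\exp(-2\pi\sqrt{-1}\,C)\in G$. If moreover $C$ has prepared eigenvalues, or every morphism of algebraic groups $G\to\mathrm{GL}_1$ is trivial (for example, if $G$ is semisimple), then $C$ is nilpotent if and only if $M$ is unipotent. -/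

import Mathlib

open Matrix

universe u v

noncomputable section

namespace FlatGBundle

/-! ### Linear algebraic groups over `ℂ`, as Zariski closed subgroups of `GL_n(ℂ)` -/

/-- The coordinates `x_{ij}` and `det⁻¹` of `GL_n`; its ring of regular functions is generated by
them, so that a regular function on `GL_n` is given by a polynomial in these variables. -/
def coords {n : ℕ} (A : Matrix (Fin n) (Fin n) ℂ) : Option (Fin n × Fin n) → ℂ
  | none => (A.det)⁻¹
  | some ij => A ij.1 ij.2

/-- Polynomials in the coordinates `x_{ij}` and `det⁻¹` of `GL_n`. -/
abbrev Reg (n : ℕ) : Type := MvPolynomial (Option (Fin n × Fin n)) ℂ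

/-- The value of a regular function at an (invertible) matrix. -/
def Reg.val {n : ℕ} (p : Reg n) (A : Matrix (Fin n) (Fin n) ℂ) : ℂ :=
  MvPolynomial.eval (coords A) p

/-- The derivative of a regular function at the identity in the direction `X`. -/
def Reg.derivOne {n : ℕ} (p : Reg n) (X : Matrix (Fin n) (Fin n) ℂ) : ℂ :=
  deriv (fun s : ℂ => p.val (1 + s • X)) 0

/-- `G` is a linear algebraic group: a Zariski closed subgroup of `GL_n(ℂ)`. -/
def IsAlgebraic {n : ℕ} (G : Subgroup (GL (Fin n) ℂ)) : Prop :=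
  ∃ S : Set (Reg n), ∀ g : GL (Fin n) ℂ, g ∈ G ↔ ∀ p ∈ S, p.val (g : Matrix (Fin n) (Fin n) ℂ) = 0

/-- The Lie algebra of `G`: the tangent space of `G` at the identity, i.e. the matrices `X` along
which every regular function that vanishes on `G` has zero derivative at the identity. -/
def lieAlg {n : ℕ} (G : Subgroup (GL (Fin n) ℂ)) : Set (Matrix (Fin n) (Fin n) ℂ) :=
  {X | ∀ p : Reg n, (∀ g ∈ G, p.val (g : Matrix (Fin n) (Fin n) ℂ) = 0) → p.derivOne X = 0}

/-- A morphism of algebraic groups `G → GL_N`: a group homomorphism whose matrix entries are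
(restrictions of) regular functions. -/
structure RegularHom {n : ℕ} (G : Subgroup (GL (Fin n) ℂ)) (N : ℕ) where
  toHom : G →* GL (Fin N) ℂ
  entry : Fin N → Fin N → Reg n
  entry_val : ∀ (g : G) (k l : Fin N),
    (toHom g : Matrix (Fin N) (Fin N) ℂ) k l
      = (entry k l).val ((g : GL (Fin n) ℂ) : Matrix (Fin n) (Fin n) ℂ)

/-- The differential `dφ : 𝔤 → 𝔤𝔩_N` of a morphism of algebraic groups. On the Lie algebra of `G`
it does not depend on the regular functions chosen to represent the entries of `φ`. -/
def RegularHom.differential {n : ℕ} {G : Subgroup (GL (Fin n) ℂ)} {N : ℕ} (φ : RegularHom G N)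
    (X : Matrix (Fin n) (Fin n) ℂ) : Matrix (Fin N) (Fin N) ℂ :=
  Matrix.of fun k l => (φ.entry k l).derivOne X

/-- Distinct eigenvalues of `A` do not differ by integers. -/
def MatrixWeaklyPrepared {N : ℕ} (A : Matrix (Fin N) (Fin N) ℂ) : Prop :=
  ∀ x ∈ spectrum ℂ A, ∀ y ∈ spectrum ℂ A, x ≠ y → ∀ k : ℤ, x - y ≠ (k : ℂ)

/-- `X ∈ 𝔤` has weakly prepared eigenvalues: for some injective morphism of algebraic groups
`φ : G → GL_N`, distinct eigenvalues of `dφ(X)` do not differ by integers. -/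
def WeaklyPrepared {n : ℕ} (G : Subgroup (GL (Fin n) ℂ)) (X : Matrix (Fin n) (Fin n) ℂ) : Prop :=
  ∃ N : ℕ, 0 < N ∧ ∃ φ : RegularHom G N, Function.Injective φ.toHom ∧
    MatrixWeaklyPrepared (φ.differential X)

/-- `X ∈ 𝔤` has prepared eigenvalues: for some injective morphism of algebraic groups
`φ : G → GL_N`, distinct eigenvalues of `dφ(X)` do not differ by integers, and moreover the only
possible integer eigenvalue of `dφ(X)` is `0`. -/
def Prepared {n : ℕ} (G : Subgroup (GL (Fin n) ℂ)) (X : Matrix (Fin n) (Fin n) ℂ) : Prop :=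
  ∃ N : ℕ, 0 < N ∧ ∃ φ : RegularHom G N, Function.Injective φ.toHom ∧
    MatrixWeaklyPrepared (φ.differential X) ∧
    ∀ k : ℤ, (k : ℂ) ∈ spectrum ℂ (φ.differential X) → k = 0

/-- Every algebraic character `G → GL_1` is trivial (for example, `G` is semisimple). -/
def NoCharacters {n : ℕ} (G : Subgroup (GL (Fin n) ℂ)) : Prop :=
  ∀ χ : RegularHom G 1, ∀ g : G, χ.toHom g = 1

/-! ### Holomorphic principal bundles over a domain in `ℂ` -/

/-- A `G`-valued function, as a matrix-valued function. -/
def mat {n : ℕ} {G : Subgroup (GL (Fin n) ℂ)} (h : ℂ → G) (z : ℂ) : Matrix (Fin n) (Fin n) ℂ :=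
  ((h z : GL (Fin n) ℂ) : Matrix (Fin n) (Fin n) ℂ)

/-- Holomorphy of a matrix-valued function (entrywise). -/
def HolOn {n : ℕ} (A : ℂ → Matrix (Fin n) (Fin n) ℂ) (U : Set ℂ) : Prop :=
  ∀ k l, DifferentiableOn ℂ (fun z => A z k l) U

/-- The entrywise derivative `d/dz` of a matrix-valued function. -/
def matDeriv {n : ℕ} (A : ℂ → Matrix (Fin n) (Fin n) ℂ) (z : ℂ) : Matrix (Fin n) (Fin n) ℂ :=
  Matrix.of fun k l => deriv (fun w => A w k l) z

/-- A holomorphic principal `G`-bundle (with right action) on an open set `D ⊆ ℂ`: a total space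
`Total → D` on whose fibres `G` acts simply transitively from the right, with an atlas of local
frames (sections over open sets that cover `D`; a frame `σ` is the same as the local trivialization
`(x, g) ↦ σ(x) g`) whose transition functions are holomorphic maps to `G`. The complex structure of
the total space is the one for which these trivializations are biholomorphic. -/
structure PrincipalBundle {n : ℕ} (G : Subgroup (GL (Fin n) ℂ)) (D : Set ℂ) where
  Total : Type u
  proj : Total → ℂ
  proj_mem : ∀ e, proj e ∈ D
  act : Total → G → Total
  act_one : ∀ e, act e 1 = e
  act_mul : ∀ e g h, act e (g * h) = act (act e g) h
  proj_act : ∀ e g, proj (act e g) = proj e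
  simply_transitive : ∀ e e', proj e = proj e' → ∃! g, act e g = e'
  Index : Type v
  dom : Index → Set ℂ
  isOpen_dom : ∀ i, IsOpen (dom i)
  dom_subset : ∀ i, dom i ⊆ D
  cover : ∀ x ∈ D, ∃ i, x ∈ dom i
  frame : Index → ℂ → Total
  proj_frame : ∀ i, ∀ x ∈ dom i, proj (frame i x) = x
  transition : ∀ i j, ∃ g : ℂ → G, HolOn (mat g) (dom i ∩ dom j) ∧
    ∀ x ∈ dom i ∩ dom j, frame j x = act (frame i x) (g x)

/-- A connection on a principal `G`-bundle on `D` with at most a logarithmic pole at `0`. In the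
local frame `σ_i` it is given by the `𝔤`-valued logarithmic `1`-form `form i · dz/z`, i.e.
`form i` is the `𝔤`-component of `∇` evaluated at the generator `z d/dz` of the logarithmic
tangent sheaf, and if `σ_j = σ_i g`, then the two forms are related by the gauge transformation
`A_j = g⁻¹ dg + g⁻¹ A_i g`, written here as `g (form j) = z g' + (form i) g`. -/
structure LogConnection {n : ℕ} {G : Subgroup (GL (Fin n) ℂ)} {D : Set ℂ}
    (P : PrincipalBundle.{u, v} G D) where
  form : P.Index → ℂ → Matrix (Fin n) (Fin n) ℂ
  form_hol : ∀ i, HolOn (form i) (P.dom i)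
  form_mem : ∀ i, ∀ x ∈ P.dom i, form i x ∈ lieAlg G
  gauge : ∀ i j, ∀ g : ℂ → G, HolOn (mat g) (P.dom i ∩ P.dom j) →
    (∀ x ∈ P.dom i ∩ P.dom j, P.frame j x = P.act (P.frame i x) (g x)) →
    ∀ x ∈ P.dom i ∩ P.dom j, mat g x * form j x = x • matDeriv (mat g) x + form i x * mat g x

variable {n : ℕ} {G : Subgroup (GL (Fin n) ℂ)} {D : Set ℂ} {P : PrincipalBundle.{u, v} G D}

/-- `C` is the residue of the connection at `0`, read as an element of `𝔤` through the
trivialization `g ↦ e g` of the fibre over `0`: in a local frame `σ_i` with `e = σ_i(0) g` it is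
`Ad(g⁻¹)` of the residue at `0` of the connection form. -/
def LogConnection.HasResidue (N : LogConnection P) (e : P.Total)
    (C : Matrix (Fin n) (Fin n) ℂ) : Prop :=
  ∃ i, (0 : ℂ) ∈ P.dom i ∧ ∃ g : G, e = P.act (P.frame i 0) g ∧
    C = ((g⁻¹ : G) : GL (Fin n) ℂ).val * N.form i 0 * (g : GL (Fin n) ℂ).val

/-- `τ` is a fundamental framing (flat holomorphic section) over `V`: for `τ = σ_i h`, the
connection form `h⁻¹ dh + h⁻¹ A_i h` of the frame `τ` vanishes. -/
def LogConnection.IsFlatSection (N : LogConnection P) (V : Set ℂ) (τ : ℂ → P.Total) : Prop :=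
  (∀ x ∈ V, P.proj (τ x) = x) ∧
  ∀ i, ∃ h : ℂ → G, HolOn (mat h) (V ∩ P.dom i) ∧
    ∀ x ∈ V ∩ P.dom i, τ x = P.act (P.frame i x) (h x) ∧
      x • matDeriv (mat h) x + N.form i x * mat h x = 0

/-- `s` is an analytic continuation of fundamental framings along the path `γ` in `D ∖ {0}`. -/
def LogConnection.IsContinuation (N : LogConnection P) (γ : ℝ → ℂ) (s : ℝ → P.Total) : Prop :=
  ∀ t₀ ∈ Set.Icc (0 : ℝ) 1, ∃ V : Set ℂ, IsOpen V ∧ V ⊆ D \ {0} ∧ γ t₀ ∈ V ∧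
    ∃ τ : ℂ → P.Total, N.IsFlatSection V τ ∧
      ∀ᶠ t in nhdsWithin t₀ (Set.Icc 0 1), s t = τ (γ t)

/-- `M` is the monodromy of the connection along the loop `γ`, where the fibre over the base point
is identified with `G` by `g ↦ e g`: continuation along `γ` carries `e` to `e M`, that is, it is
the left translation by `M`. -/
def LogConnection.IsMonodromy (N : LogConnection P) (γ : ℝ → ℂ) (e : P.Total) (M : G) : Prop :=
  ∃ s : ℝ → P.Total, N.IsContinuation γ s ∧ s 0 = e ∧ s 1 = P.act e M

/-- The circle around `0` through `r`, in the positive direction. -/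
def circleLoop (r : ℝ) (t : ℝ) : ℂ :=
  (r : ℂ) * Complex.exp (2 * Real.pi * Complex.I * t)

end FlatGBundle

end

/-!
Pull the punctured disc back to its universal cover, with coordinate `w = log z` in a half plane. A
flat section through a given point becomes a holomorphic frame `h(w)`, with values in `G` near
`Re w = -∞`, that satisfies `h' = -v(e^w) h` and `h(w + 2πi) = h(w) M`; here `v dz/z` is the
connection form and `v(0) = C`.

*Existence and uniqueness of the monodromy.* Flat sections exist locally, because a linear
differential equation with coefficients in the Lie algebra has its solutions in `G`
(`mem_matSet_of_hasDerivAt`: regular functions that vanish on `G` vanish to infinite order along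
such a solution). Hence the total space, with the topology generated by flat sections, is a covering
space of the punctured disc (`isCoveringMapOn_flatProj`). The half plane is simply connected, so the
exponential map lifts (`exists_multivaluedFlat`), and continuation along a loop is unique path
lifting (`LogConnection.IsMonodromy.unique`).

*Conjugacy.* Let `φ` be an injective morphism such that distinct eigenvalues of `dφ(C)` do not
differ by integers. Then `ad(dφ(C))` has no nonzero integral eigenvalue, and since `dφ` is injective on the
Lie algebra, neither has `ad C` there (`exists_gauge_coefficient`). Gauge transformations
`exp(z^j Y)` with `Y` in the Lie algebra therefore remove the coefficients of `v - C` up to any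
given order (`LogFlat.exists_order`). Once `v - C` vanishes to an order that is large compared with `‖C‖`,
the function `exp(wC) h(w)` and its inverse converge as `Re w → -∞`, so that the limit `K` is an
invertible matrix in the Zariski closed group `G`, and comparison of the limits along `w` and
`w + 2πi` gives `exp(2πiC) K M = K` (`LogFlat.exists_conj_of_order`). No convergence of a formal
gauge transformation is needed.

*Nilpotency.* A unipotent matrix `u` lies on a curve that interpolates the powers `u ^ m` and is
polynomial in `m`. If `exp(-2πiC)` is unipotent, the curve of its powers is mapped by `φ` to such a
curve, so `exp(-2πi dφ(C))` is unipotent, and `dφ(C)` has a single eigenvalue, an integer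
(`exists_forall_spectrum_eq`). It is zero if `C` is prepared, and also if `G` has no characters, as
then `dφ(C)` has trace zero; so `dφ(C)` is nilpotent. The residue itself has integral eigenvalues;
if one were nonzero, a suitable root `g = exp(-2πiC/m)` would have the eigenvalue `-1`, while `φ(g)`
and `g ^ m` are unipotent. By Zariski closedness `G` contains the product of `g` with the unipotent
`m`-th root of `g ^ (-m)`. As `φ` maps this product to `1`, it equals `1`, and `g` is unipotent
(`eq_one_of_pow_unipotent`), a contradiction.
-/

noncomputable section

namespace FlatGBundle

attribute [local instance] Matrix.linftyOpNormedAddCommGroup Matrix.linftyOpNormedSpace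
  Matrix.linftyOpNormedRing Matrix.linftyOpNormedAlgebra

section

/-- Square complex matrices, on which the operator norm for the sup norm on `ℂⁿ` is used. -/
abbrev Mat (n : ℕ) : Type := Matrix (Fin n) (Fin n) ℂ

variable {n : ℕ}

/-! ### Holomorphic matrix-valued functions -/

theorem hasDerivAt_matrix {A : ℂ → Mat n} {A' : Mat n} {z : ℂ} :
    HasDerivAt A A' z ↔ ∀ i j, HasDerivAt (fun w => A w i j) (A' i j) z := by
  have h1 : HasDerivAt A A' z ↔ ∀ i, HasDerivAt (fun w => A w i) (A' i) z := hasDerivAt_pi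
  rw [h1]
  exact forall_congr' fun i => hasDerivAt_pi

theorem differentiableOn_matrix {A : ℂ → Mat n} {U : Set ℂ} :
    DifferentiableOn ℂ A U ↔ HolOn A U := by
  have h1 : DifferentiableOn ℂ A U ↔ ∀ i, DifferentiableOn ℂ (fun w => A w i) U :=
    differentiableOn_pi
  rw [h1]
  exact forall_congr' fun i => differentiableOn_pi

theorem matDeriv_eq {A : ℂ → Mat n} {A' : Mat n} {z : ℂ} (h : HasDerivAt A A' z) :
    matDeriv A z = A' := by
  ext i j
  exact (hasDerivAt_matrix.1 h i j).deriv

theorem HolOn.hasDerivAt {A : ℂ → Mat n} {U : Set ℂ} (h : HolOn A U) (hU : IsOpen U) {z : ℂ}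
    (hz : z ∈ U) : HasDerivAt A (matDeriv A z) z :=
  hasDerivAt_matrix.2 fun i j => ((h i j).differentiableAt (hU.mem_nhds hz)).hasDerivAt

theorem contDiff_entry (i j : Fin n) : ContDiff ℂ 1 fun A : Mat n => A i j :=
  (LinearMap.toContinuousLinearMap (Matrix.entryLinearMap ℂ ℂ i j)).contDiff

theorem differentiable_entry (i j : Fin n) : Differentiable ℂ fun A : Mat n => A i j :=
  (contDiff_entry i j).differentiable one_ne_zero

theorem differentiable_det : Differentiable ℂ fun A : Mat n => A.det := by
  simp only [Matrix.det_apply]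
  refine Differentiable.fun_sum fun σ _ => Differentiable.fun_const_smul ?_ _
  exact (contDiff_prod (f := fun i (A : Mat n) => A (σ i) i)
    fun i _ => contDiff_entry (σ i) i).differentiable one_ne_zero

theorem hasDerivAt_one_add_smul_mul (X g : Mat n) :
    HasDerivAt (fun s : ℂ => (1 + s • X) * g) (X * g) 0 := by
  have h : HasDerivAt (fun s : ℂ => 1 + s • X) ((1 : ℂ) • X) 0 :=
    ((hasDerivAt_id (0 : ℂ)).smul_const X).const_add (1 : Mat n)
  rw [one_smul] at h
  exact h.mul_const g

theorem hasDerivAt_det_one_add_smul (Y : Mat n) :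
    HasDerivAt (fun s : ℂ => (1 + s • Y).det) Y.trace 0 := by
  have h (s : ℂ) := Matrix.det_one_add_smul s Y
  set q := ((1 + (Polynomial.X : Polynomial ℂ) • Y.map Polynomial.C).det).divX.divX
  have e1 : HasDerivAt (fun s : ℂ => 1 + Y.trace * s) (Y.trace * 1) 0 :=
    ((hasDerivAt_id (0 : ℂ)).const_mul Y.trace).const_add (1 : ℂ)
  have e2 := (q.hasDerivAt (0 : ℂ)).mul ((hasDerivAt_id (0 : ℂ)).pow 2)
  have e3 := e1.add e2
  have e4 : (fun s : ℂ => (1 + s • Y).det) =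
      (fun s : ℂ => 1 + Y.trace * s) + (fun s => q.eval s) * id ^ 2 := by
    funext s
    simp only [h, Pi.add_apply, Pi.mul_apply, Pi.pow_apply, id]
  rw [e4]
  exact e3.congr_deriv (by simp)

/-- Jacobi's formula along a curve with logarithmic derivative `Y`. -/
theorem hasDerivAt_det {A : ℂ → Mat n} {Y : Mat n} {z : ℂ} (h : HasDerivAt A (Y * A z) z) :
    HasDerivAt (fun w => (A w).det) (Y.trace * (A z).det) z := by
  have h0 := (differentiable_det (A z)).hasFDerivAt
  have h1 := h0.comp_hasDerivAt z h
  have h3 : HasDerivAt (fun s : ℂ => ((1 + s • Y) * A z).det)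
      (fderiv ℂ (fun A : Mat n => A.det) (A z) (Y * A z)) 0 := by
    refine HasFDerivAt.comp_hasDerivAt (l := fun A : Mat n => A.det) (0 : ℂ) ?_
      (hasDerivAt_one_add_smul_mul Y (A z))
    rw [zero_smul, add_zero, one_mul]
    exact h0
  have h4 : HasDerivAt (fun s : ℂ => ((1 + s • Y) * A z).det) (Y.trace * (A z).det) 0 := by
    simp_rw [Matrix.det_mul]
    exact (hasDerivAt_det_one_add_smul Y).mul_const _
  rw [← h3.unique h4]
  exact h1

/-! ### Invariant vector fields on `GL_n` -/

/-- The right-invariant vector field `A ↦ Y A` on `GL_n`, as a derivation of the ring of regular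
functions. Jacobi's formula gives its effect on the coordinate `det⁻¹`. -/
def invField : Mat n →ₗ[ℂ] Derivation ℂ (Reg n) (Reg n) where
  toFun Y := MvPolynomial.mkDerivation ℂ fun c => match c with
    | none => -(Y.trace • MvPolynomial.X none)
    | some ij => ∑ k, Y ij.1 k • MvPolynomial.X (some (k, ij.2))
  map_add' Y Z := by
    refine MvPolynomial.derivation_ext fun c => ?_
    rcases c with _ | ij
    · simp [MvPolynomial.mkDerivation_X, add_smul, add_comm]
    · simp [MvPolynomial.mkDerivation_X, add_smul, Finset.sum_add_distrib]
  map_smul' a Y := by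
    refine MvPolynomial.derivation_ext fun c => ?_
    rcases c with _ | ij
    · simp [MvPolynomial.mkDerivation_X, mul_smul]
    · simp [MvPolynomial.mkDerivation_X, mul_smul, Finset.smul_sum]

@[simp] theorem val_add (p q : Reg n) (A : Mat n) :
    Reg.val (p + q) A = p.val A + q.val A := map_add _ _ _

@[simp] theorem val_mul (p q : Reg n) (A : Mat n) :
    Reg.val (p * q) A = p.val A * q.val A := map_mul _ _ _

@[simp] theorem val_smul (a : ℂ) (p : Reg n) (A : Mat n) :
    Reg.val (a • p) A = a * p.val A := MvPolynomial.smul_eval _ _ _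

@[simp] theorem val_X (c : Option (Fin n × Fin n)) (A : Mat n) :
    Reg.val (MvPolynomial.X c) A = coords A c := MvPolynomial.eval_X _

@[simp] theorem val_C (a : ℂ) (A : Mat n) :
    Reg.val (MvPolynomial.C a) A = a := MvPolynomial.eval_C _

theorem val_sum {ι : Type*} (s : Finset ι) (f : ι → Reg n) (A : Mat n) :
    Reg.val (∑ i ∈ s, f i) A = ∑ i ∈ s, (f i).val A := map_sum _ _ _

theorem val_invField_X_none (Y A : Mat n) :
    (invField Y (MvPolynomial.X none)).val A = -(Y.trace * A.det⁻¹) := by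
  have : invField Y (MvPolynomial.X none) = (-Y.trace) • MvPolynomial.X none := by
    simp [invField, MvPolynomial.mkDerivation_X]
  rw [this, val_smul, val_X, coords, neg_mul]

theorem val_invField_X_some (Y A : Mat n) (ij : Fin n × Fin n) :
    (invField Y (MvPolynomial.X (some ij))).val A = (Y * A) ij.1 ij.2 := by
  have : invField Y (MvPolynomial.X (some ij)) =
      ∑ k, Y ij.1 k • MvPolynomial.X (some (k, ij.2)) := by
    simp [invField, MvPolynomial.mkDerivation_X]
  rw [this, val_sum]
  simp [coords, Matrix.mul_apply]

/-- The chain rule for regular functions. -/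
theorem hasDerivAt_val (p : Reg n) {A : ℂ → Mat n} {Y : Mat n} {z : ℂ}
    (h : HasDerivAt A (Y * A z) z) (hdet : (A z).det ≠ 0) :
    HasDerivAt (fun w => p.val (A w)) ((invField Y p).val (A z)) z := by
  induction p using MvPolynomial.induction_on with
  | C a =>
    have : invField Y (MvPolynomial.C a) = 0 := by
      rw [← MvPolynomial.algebraMap_eq, Derivation.map_algebraMap]
    rw [this]
    simp only [val_C]
    exact (hasDerivAt_const z a).congr_deriv (map_zero _).symm
  | add p q hp hq =>
    simp only [val_add, map_add]
    exact hp.add hq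
  | mul_X p c hp =>
    have hc : HasDerivAt (fun w => coords (A w) c)
        ((invField Y (MvPolynomial.X c)).val (A z)) z := by
      rcases c with _ | ij
      · rw [val_invField_X_none]
        refine ((hasDerivAt_det h).inv hdet).congr_deriv ?_
        field_simp
      · rw [val_invField_X_some]
        exact hasDerivAt_matrix.1 h ij.1 ij.2
    simp only [val_mul, val_X, Derivation.leibniz, smul_eq_mul, val_add]
    exact (hp.mul hc).congr_deriv (by ring)

theorem deriv_val_one_add_smul_mul (p : Reg n) (X : Mat n) {g : Mat n} (hg : g.det ≠ 0) :
    deriv (fun s : ℂ => p.val ((1 + s • X) * g)) 0 = (invField X p).val g := by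
  have e : (1 + (0 : ℂ) • X) * g = g := by simp
  have h : HasDerivAt (fun s : ℂ => (1 + s • X) * g) (X * ((1 + (0 : ℂ) • X) * g)) 0 := by
    rw [e]; exact hasDerivAt_one_add_smul_mul X g
  have := (hasDerivAt_val p h (by rwa [e])).deriv
  rwa [e] at this

theorem derivOne_eq (p : Reg n) (X : Mat n) : p.derivOne X = (invField X p).val 1 := by
  have := deriv_val_one_add_smul_mul p X (g := 1) (by simp)
  simp only [mul_one] at this
  exact this

/-- The derivative of a regular function at the identity, as a linear functional. -/
def derivOneₗ (p : Reg n) : Mat n →ₗ[ℂ] ℂ where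
  toFun := p.derivOne
  map_add' X Y := by simp [derivOne_eq]
  map_smul' a X := by simp [derivOne_eq]

/-- Two-sided translates of regular functions are regular. -/
theorem exists_translate (p : Reg n) (g k : Mat n) :
    ∃ q : Reg n, ∀ A : Mat n, q.val A = p.val (g * A * k) := by
  refine ⟨MvPolynomial.bind₁ (fun c => match c with
    | none => (g.det⁻¹ * k.det⁻¹) • MvPolynomial.X none
    | some ij => ∑ b, ∑ a, (g ij.1 a * k b ij.2) • MvPolynomial.X (some (a, b))) p, fun A => ?_⟩
  simp only [Reg.val, MvPolynomial.eval, MvPolynomial.eval₂Hom_bind₁]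
  congr 2
  funext c
  rcases c with _ | ij
  · simp [coords, MvPolynomial.smul_eq_C_mul]; ring
  · simp [coords, MvPolynomial.smul_eq_C_mul, Matrix.mul_apply, Finset.sum_mul]
    refine Finset.sum_congr rfl fun b _ => Finset.sum_congr rfl fun a _ => by ring

end

section

variable {n : ℕ}

/-! ### The Lie algebra and its invariance -/

/-- The elements of `G`, as a set of matrices. -/
def matSet (G : Subgroup (GL (Fin n) ℂ)) : Set (Mat n) :=
  {A | ∃ g ∈ G, (g : Mat n) = A}

/-- The regular function `p` vanishes on `G`. -/
def VanishesOn (G : Subgroup (GL (Fin n) ℂ)) (p : Reg n) : Prop :=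
  ∀ A ∈ matSet G, p.val A = 0

variable {G : Subgroup (GL (Fin n) ℂ)}

theorem coe_mem_matSet (g : G) : ((g : GL (Fin n) ℂ) : Mat n) ∈ matSet G := ⟨g, g.2, rfl⟩

theorem one_mem_matSet : (1 : Mat n) ∈ matSet G := ⟨1, G.one_mem, rfl⟩

theorem mul_mem_matSet {A B : Mat n} (hA : A ∈ matSet G) (hB : B ∈ matSet G) :
    A * B ∈ matSet G := by
  obtain ⟨g, hg, rfl⟩ := hA
  obtain ⟨k, hk, rfl⟩ := hB
  exact ⟨g * k, G.mul_mem hg hk, rfl⟩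

theorem isUnit_det_of_mem_matSet {A : Mat n} (hA : A ∈ matSet G) : IsUnit A.det := by
  obtain ⟨g, hg, rfl⟩ := hA
  exact (Matrix.isUnit_iff_isUnit_det _).1 g.isUnit

theorem mem_matSet_of_vanishing (hG : IsAlgebraic G) {A : Mat n} (hA : IsUnit A.det)
    (h : ∀ p, VanishesOn G p → p.val A = 0) : A ∈ matSet G := by
  obtain ⟨S, hS⟩ := hG
  refine ⟨Matrix.GeneralLinearGroup.mk'' A hA, (hS _).2 fun p hp => h p ?_, rfl⟩
  rintro _ ⟨g, hg, rfl⟩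
  exact (hS g).1 hg p hp

theorem mem_lieAlg {X : Mat n} : X ∈ lieAlg G ↔ ∀ p, VanishesOn G p → derivOneₗ p X = 0 := by
  refine forall_congr' fun p => ?_
  refine imp_congr_left ⟨?_, fun h g hg => h _ ⟨g, hg, rfl⟩⟩
  rintro h _ ⟨g, hg, rfl⟩
  exact h g hg

/-- The Lie algebra of `G`, as a linear subspace of the matrices. -/
def lieSub (G : Subgroup (GL (Fin n) ℂ)) : Submodule ℂ (Mat n) where
  carrier := lieAlg G
  add_mem' {X Y} hX hY := mem_lieAlg.2 fun p hp => by
    rw [map_add, mem_lieAlg.1 hX p hp, mem_lieAlg.1 hY p hp, add_zero]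
  zero_mem' := mem_lieAlg.2 fun p _ => map_zero _
  smul_mem' a X hX := mem_lieAlg.2 fun p hp => by
    rw [map_smul, mem_lieAlg.1 hX p hp, smul_zero]

theorem isClosed_lieAlg : IsClosed (lieAlg G) :=
  Submodule.closed_of_finiteDimensional (lieSub G)

/-- Invariant vector fields in the directions of the Lie algebra are tangent to `G`. -/
theorem VanishesOn.invField {p : Reg n} (hp : VanishesOn G p) {X : Mat n} (hX : X ∈ lieAlg G) :
    VanishesOn G (invField X p) := by
  intro g hg
  obtain ⟨q, hq⟩ := exists_translate p 1 g
  have h := hX q fun k hk => by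
    rw [hq, one_mul]; exact hp _ (mul_mem_matSet ⟨k, hk, rfl⟩ hg)
  rw [← deriv_val_one_add_smul_mul p X (isUnit_det_of_mem_matSet hg).ne_zero]
  simpa only [Reg.derivOne, hq, one_mul] using h

/-- The Lie algebra is invariant under the adjoint action of `G`. -/
theorem conj_mem_lieAlg {A B X : Mat n} (hA : A ∈ matSet G) (hB : B ∈ matSet G) (hAB : A * B = 1)
    (hX : X ∈ lieAlg G) : A * X * B ∈ lieAlg G := by
  intro p hp
  obtain ⟨q, hq⟩ := exists_translate p A B
  have h := hX q fun k hk => by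
    obtain ⟨g, hg, e⟩ := mul_mem_matSet (mul_mem_matSet hA ⟨k, hk, rfl⟩) hB
    rw [hq, ← e]; exact hp g hg
  rw [← h]
  simp only [Reg.derivOne, hq, mul_add, add_mul, mul_one, hAB, Matrix.mul_smul, Matrix.smul_mul]

/-! ### Curves in `G` -/

theorem le_analyticOrderAt_sum {ι : Type*} (s : Finset ι) {f : ι → ℂ → ℂ} {x : ℂ} {k : ℕ∞}
    (h : ∀ i ∈ s, k ≤ analyticOrderAt (f i) x) : k ≤ analyticOrderAt (∑ i ∈ s, f i) x := by
  classical
  induction s using Finset.induction_on with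
  | empty =>
    rw [Finset.sum_empty, analyticOrderAt_eq_top.2 (by simp)]
    exact le_top
  | insert i s hi ih =>
    rw [Finset.sum_insert hi]
    exact (le_min (h i (by simp)) (ih fun j hj => h j (by simp [hj]))).trans
      le_analyticOrderAt_add

/-- A solution of a linear differential equation with coefficients in the Lie algebra stays in `G`
once it meets `G`. For a regular function `p` that vanishes on `G`, the derivative of `p` along the
solution is a combination of such functions again, so that `p` vanishes to infinite order at the
point where the solution meets `G`. -/
theorem mem_matSet_of_hasDerivAt (hG : IsAlgebraic G) {U : Set ℂ} (hU : IsOpen U)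
    (hUc : IsPreconnected U) {A Y : ℂ → Mat n} (hY : DifferentiableOn ℂ Y U)
    (hYmem : ∀ z ∈ U, Y z ∈ lieAlg G) (hA : ∀ z ∈ U, HasDerivAt A (Y z * A z) z)
    (hdet : ∀ z ∈ U, (A z).det ≠ 0) {x : ℂ} (hx : x ∈ U) (hAx : A x ∈ matSet G) :
    ∀ z ∈ U, A z ∈ matSet G := by
  -- a linear projection to the Lie algebra expresses `Y` through fixed elements of it
  obtain ⟨π, hπ⟩ := (lieSub G).subtype.exists_leftInverse_of_injective (Submodule.ker_subtype _)
  let E : Fin n × Fin n → Mat n := fun c => (π (Matrix.single c.1 c.2 1) : Mat n)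
  have hE (c) : E c ∈ lieAlg G := (π _).2
  have hYE : ∀ z ∈ U, Y z = ∑ c : Fin n × Fin n, Y z c.1 c.2 • E c := by
    intro z hz
    have h1 : ((π (Y z) : lieSub G) : Mat n) = Y z :=
      congrArg Subtype.val (LinearMap.congr_fun hπ ⟨Y z, hYmem z hz⟩)
    conv_lhs => rw [← h1, Matrix.matrix_eq_sum_single (Y z)]
    simp only [E, map_sum, Submodule.coe_sum, Fintype.sum_prod_type]
    refine Finset.sum_congr rfl fun i _ => Finset.sum_congr rfl fun j _ => ?_
    rw [← Submodule.coe_smul, ← map_smul, Matrix.smul_single, smul_eq_mul, mul_one]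
  have hd (p : Reg n) : ∀ z ∈ U, HasDerivAt (fun w => p.val (A w))
      (∑ c : Fin n × Fin n, Y z c.1 c.2 * (invField (E c) p).val (A z)) z := by
    intro z hz
    refine (hasDerivAt_val p (hA z hz) (hdet z hz)).congr_deriv ?_
    conv_lhs => rw [hYE z hz]
    let L : Mat n →ₗ[ℂ] ℂ :=
      { toFun := fun X => (invField X p).val (A z)
        map_add' := fun _ _ => by simp
        map_smul' := fun _ _ => by simp }
    exact (map_sum L _ _).trans (Finset.sum_congr rfl fun c _ => map_smul L _ _)
  have han (p : Reg n) : AnalyticOnNhd ℂ (fun w => p.val (A w)) U :=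
    DifferentiableOn.analyticOnNhd
      (fun z hz => (hd p z hz).differentiableAt.differentiableWithinAt) hU
  have hord : ∀ k : ℕ, ∀ p, VanishesOn G p →
      (k : ℕ∞) ≤ analyticOrderAt (fun w => p.val (A w)) x := by
    intro k
    induction k with
    | zero => intro p hp; simp
    | succ k ih =>
      intro p hp
      have h1 := (han p x hx).analyticOrderAt_deriv_add_one
      have h2 : (fun w => p.val (A w) - p.val (A x)) = fun w => p.val (A w) := by
        funext w; rw [hp _ hAx, sub_zero]
      simp only [h2] at h1
      rw [← h1, Nat.cast_add, Nat.cast_one]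
      gcongr
      have h3 : deriv (fun w => p.val (A w)) =ᶠ[nhds x]
          ∑ c : Fin n × Fin n, (fun z => Y z c.1 c.2) * fun z => (invField (E c) p).val (A z) := by
        filter_upwards [hU.mem_nhds hx] with z hz
        rw [(hd p z hz).deriv]
        simp
      rw [analyticOrderAt_congr h3]
      refine le_analyticOrderAt_sum _ fun c _ => ?_
      have h4 : AnalyticAt ℂ (fun z => Y z c.1 c.2) x :=
        DifferentiableOn.analyticAt (differentiableOn_matrix.1 hY c.1 c.2) (hU.mem_nhds hx)
      rw [analyticOrderAt_mul h4 (han _ x hx)]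
      exact (ih _ (hp.invField (hE c))).trans le_add_self
  intro z hz
  refine mem_matSet_of_vanishing hG (hdet z hz).isUnit fun p hp => ?_
  have h1 : analyticOrderAt (fun w => p.val (A w)) x = ⊤ := by
    refine ENat.eq_top_iff_forall_ge.2 fun k => hord k p hp
  exact (han p).eqOn_zero_of_preconnected_of_eventuallyEq_zero hUc hx
    (analyticOrderAt_eq_top.1 h1) hz

open NormedSpace (exp)

theorem hasDerivAt_exp_smul (X : Mat n) (t : ℂ) :
    HasDerivAt (fun s : ℂ => exp (s • X)) (X * exp (t • X)) t :=
  hasDerivAt_exp_smul_const' X t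

theorem hasDerivAt_exp_smul' (X : Mat n) (t : ℂ) :
    HasDerivAt (fun s : ℂ => exp (s • X)) (exp (t • X) * X) t :=
  hasDerivAt_exp_smul_const X t

theorem det_exp_ne_zero (X : Mat n) : (exp X).det ≠ 0 :=
  ((Matrix.isUnit_iff_isUnit_det _).1 (Matrix.isUnit_exp X)).ne_zero

theorem exp_mem_matSet (hG : IsAlgebraic G) {X : Mat n} (hX : X ∈ lieAlg G) (t : ℂ) :
    exp (t • X) ∈ matSet G := by
  have h0 : exp ((0 : ℂ) • X) ∈ matSet G := by
    rw [zero_smul, NormedSpace.exp_zero]; exact one_mem_matSet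
  exact mem_matSet_of_hasDerivAt (A := fun t : ℂ => exp (t • X)) (Y := fun _ => X) hG isOpen_univ
    isPreconnected_univ (differentiableOn_const X) (fun _ _ => hX)
    (fun t _ => hasDerivAt_exp_smul X t) (fun t _ => det_exp_ne_zero _)
    (Set.mem_univ 0) h0 t (Set.mem_univ t)

theorem exp_smul_mul_exp_neg (X : Mat n) (t : ℂ) : exp (t • X) * exp ((-t) • X) = 1 := by
  rw [← Matrix.exp_add_of_commute _ _ (((Commute.refl X).smul_left t).smul_right (-t)), ← add_smul]
  simp

theorem exp_neg_mul_exp_smul (X : Mat n) (t : ℂ) : exp ((-t) • X) * exp (t • X) = 1 := by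
  simpa using exp_smul_mul_exp_neg X (-t)

theorem exp_add_smul (X : Mat n) (s t : ℂ) : exp ((s + t) • X) = exp (s • X) * exp (t • X) := by
  rw [← Matrix.exp_add_of_commute _ _ (((Commute.refl X).smul_left s).smul_right t), ← add_smul]

theorem hasDerivAt_conj_exp (C X : Mat n) :
    HasDerivAt (fun t : ℂ => exp (t • C) * X * exp ((-t) • C)) (C * X - X * C) 0 := by
  have h1 := (hasDerivAt_exp_smul C 0).mul_const X
  have h2 := hasDerivAt_exp_smul (-C) 0
  simp only [smul_neg, ← neg_smul] at h2
  refine (h1.mul h2).congr_deriv ?_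
  simp [sub_eq_add_neg]

/-- The Lie algebra is closed under commutators: `[C, X]` is the derivative at `0` of the curve
`exp(tC) X exp(-tC)`, on which the linear equations of the Lie algebra vanish. -/
theorem bracket_mem_lieAlg (hG : IsAlgebraic G) {C X : Mat n} (hC : C ∈ lieAlg G)
    (hX : X ∈ lieAlg G) : C * X - X * C ∈ lieAlg G := by
  refine mem_lieAlg.2 fun p hp => ?_
  have h1 := (LinearMap.toContinuousLinearMap (derivOneₗ p)).hasFDerivAt.comp_hasDerivAt (0 : ℂ)
    (hasDerivAt_conj_exp C X)
  refine h1.unique ((hasDerivAt_const (0 : ℂ) (0 : ℂ)).congr_of_eventuallyEq ?_)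
  refine Filter.Eventually.of_forall fun t => ?_
  exact mem_lieAlg.1 (conj_mem_lieAlg (exp_mem_matSet hG hC t) (exp_mem_matSet hG hC (-t))
    (exp_smul_mul_exp_neg C t) hX) p hp

end

section

variable {n : ℕ} {G : Subgroup (GL (Fin n) ℂ)}

open NormedSpace (exp)

/-! ### Morphisms of algebraic groups -/

/-- The matrix of regular functions that represents the morphism `φ`, evaluated at a matrix. -/
def RegularHom.mval {N : ℕ} (φ : RegularHom G N) (A : Mat n) : Mat N :=
  Matrix.of fun k l => (φ.entry k l).val A

variable {N : ℕ} (φ : RegularHom G N)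

theorem RegularHom.mval_coe (g : G) :
    φ.mval ((g : GL (Fin n) ℂ) : Mat n) = (φ.toHom g : Mat N) := by
  ext k l
  exact (φ.entry_val g k l).symm

theorem RegularHom.mval_mul {A B : Mat n} (hA : A ∈ matSet G) (hB : B ∈ matSet G) :
    φ.mval (A * B) = φ.mval A * φ.mval B := by
  obtain ⟨g, hg, rfl⟩ := hA
  obtain ⟨k, hk, rfl⟩ := hB
  have h1 := φ.mval_coe ⟨g, hg⟩
  have h2 := φ.mval_coe ⟨k, hk⟩
  have h3 := φ.mval_coe (⟨g, hg⟩ * ⟨k, hk⟩)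
  rw [map_mul] at h3
  exact h3.trans (congrArg₂ (· * ·) h1.symm h2.symm)

theorem RegularHom.mval_one : φ.mval 1 = 1 := by
  have h := φ.mval_coe 1
  rw [map_one] at h
  exact h

theorem RegularHom.mval_pow {A : Mat n} (hA : A ∈ matSet G) (m : ℕ) :
    A ^ m ∈ matSet G ∧ φ.mval (A ^ m) = φ.mval A ^ m := by
  induction m with
  | zero => simpa using ⟨one_mem_matSet, φ.mval_one⟩
  | succ m ih =>
    refine ⟨?_, ?_⟩
    · rw [pow_succ]; exact mul_mem_matSet ih.1 hA
    · rw [pow_succ, φ.mval_mul ih.1 hA, ih.2, pow_succ]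

theorem RegularHom.eq_one_of_mval (hφ : Function.Injective φ.toHom) {A : Mat n}
    (hA : A ∈ matSet G) (h : φ.mval A = 1) : A = 1 := by
  obtain ⟨g, hg, rfl⟩ := hA
  have h1 : φ.toHom ⟨g, hg⟩ = 1 := Units.ext ((φ.mval_coe ⟨g, hg⟩).symm.trans h)
  have h2 := hφ (h1.trans (map_one φ.toHom).symm)
  exact congrArg (fun x : G => ((x : GL (Fin n) ℂ) : Mat n)) h2

/-- The differential of a morphism of algebraic groups, as a linear map. -/
def RegularHom.differentialₗ : Mat n →ₗ[ℂ] Mat N where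
  toFun := φ.differential
  map_add' X Y := by ext k l; exact map_add (derivOneₗ (φ.entry k l)) X Y
  map_smul' a X := by ext k l; exact map_smul (derivOneₗ (φ.entry k l)) a X

theorem RegularHom.hasDerivAt_mval {A : ℂ → Mat n} {X : Mat n} {z : ℂ}
    (h : HasDerivAt A X z) (hA : A z = 1) :
    HasDerivAt (fun w => φ.mval (A w)) (φ.differential X) z := by
  refine hasDerivAt_matrix.2 fun k l => ?_
  have h' : HasDerivAt A (X * A z) z := by rwa [hA, mul_one]
  refine (hasDerivAt_val (φ.entry k l) h' (by simp [hA])).congr_deriv ?_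
  rw [hA]
  exact (derivOne_eq _ _).symm

/-- A one-parameter group of matrices is the exponential of its derivative at the origin. -/
theorem eq_exp_of_hasDerivAt {ψ : ℂ → Mat N} {X : Mat N} (h0 : ψ 0 = 1)
    (hψ : ∀ s t, ψ (s + t) = ψ s * ψ t) (hX : HasDerivAt ψ X 0) (t : ℂ) :
    ψ t = exp (t • X) := by
  have h1 (t : ℂ) : HasDerivAt ψ (X * ψ t) t := by
    have h2 : HasDerivAt (fun s => ψ (s - t)) X t := by
      refine HasDerivAt.comp_sub_const t t ?_
      rwa [sub_self]
    refine (h2.mul_const (ψ t)).congr_of_eventuallyEq (Filter.Eventually.of_forall fun s => ?_)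
    change ψ s = ψ (s - t) * ψ t
    rw [← hψ, sub_add_cancel]
  have h2 (t : ℂ) : HasDerivAt (fun t => exp (t • (-X)) * ψ t) 0 t := by
    refine ((hasDerivAt_exp_smul' (-X) t).mul (h1 t)).congr_deriv ?_
    simp [mul_assoc]
  have h3 : exp (t • (-X)) * ψ t = 1 := by
    have := is_const_of_deriv_eq_zero (fun t => (h2 t).differentiableAt)
      (fun t => (h2 t).deriv) t 0
    simpa [h0] using this
  rw [smul_neg, ← neg_smul] at h3
  calc ψ t = (exp (t • X) * exp ((-t) • X)) * ψ t := by rw [exp_smul_mul_exp_neg, one_mul]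
    _ = exp (t • X) := by rw [mul_assoc, h3, mul_one]

theorem RegularHom.mval_exp (hG : IsAlgebraic G) {X : Mat n} (hX : X ∈ lieAlg G) (t : ℂ) :
    φ.mval (exp (t • X)) = exp (t • φ.differential X) := by
  refine eq_exp_of_hasDerivAt (ψ := fun t : ℂ => φ.mval (exp (t • X))) ?_ (fun s t => ?_) ?_ t
  · simpa using φ.mval_one
  · simp only [exp_add_smul]
    exact φ.mval_mul (exp_mem_matSet hG hX s) (exp_mem_matSet hG hX t)
  · refine φ.hasDerivAt_mval ?_ (by simp)
    refine (hasDerivAt_exp_smul X 0).congr_deriv (by simp)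

theorem eq_of_exp_eq {X Y : Mat n} (h : ∀ t : ℂ, exp (t • X) = exp (t • Y)) : X = Y := by
  have h1 := hasDerivAt_exp_smul X 0
  have h2 := hasDerivAt_exp_smul Y 0
  simp only [h] at h1
  simpa using h1.unique h2

theorem RegularHom.eq_zero_of_differential (hG : IsAlgebraic G) (hφ : Function.Injective φ.toHom)
    {X : Mat n} (hX : X ∈ lieAlg G) (h : φ.differential X = 0) : X = 0 := by
  refine eq_of_exp_eq fun t => ?_
  have h1 := φ.mval_exp hG hX t
  rw [h, smul_zero, NormedSpace.exp_zero] at h1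
  rw [φ.eq_one_of_mval hφ (exp_mem_matSet hG hX t) h1, smul_zero, NormedSpace.exp_zero]

theorem exp_conj_of_mul_eq_one {A B : Mat n} (hAB : A * B = 1) (X : Mat n) (t : ℂ) :
    exp (t • (A * X * B)) = A * exp (t • X) * B := by
  have hB : B = A⁻¹ := (Matrix.inv_eq_right_inv hAB).symm
  have hA : IsUnit A := (Matrix.isUnit_iff_isUnit_det _).2 (Matrix.isUnit_det_of_right_inverse hAB)
  rw [hB, ← Matrix.exp_conj _ _ hA, Matrix.mul_smul, Matrix.smul_mul]

theorem RegularHom.differential_conj (hG : IsAlgebraic G) {A B X : Mat n} (hA : A ∈ matSet G)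
    (hB : B ∈ matSet G) (hAB : A * B = 1) (hX : X ∈ lieAlg G) :
    φ.differential (A * X * B) = φ.mval A * φ.differential X * φ.mval B := by
  have hAB' : φ.mval A * φ.mval B = 1 := by rw [← φ.mval_mul hA hB, hAB, φ.mval_one]
  refine eq_of_exp_eq fun t => ?_
  rw [← φ.mval_exp hG (conj_mem_lieAlg hA hB hAB hX), exp_conj_of_mul_eq_one hAB,
    exp_conj_of_mul_eq_one hAB', ← φ.mval_exp hG hX,
    φ.mval_mul (mul_mem_matSet hA (exp_mem_matSet hG hX t)) hB,
    φ.mval_mul hA (exp_mem_matSet hG hX t)]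

theorem RegularHom.differential_bracket (hG : IsAlgebraic G) {C X : Mat n} (hC : C ∈ lieAlg G)
    (hX : X ∈ lieAlg G) : φ.differential (C * X - X * C) =
      φ.differential C * φ.differential X - φ.differential X * φ.differential C := by
  have h1 := (LinearMap.toContinuousLinearMap φ.differentialₗ).hasFDerivAt.comp_hasDerivAt (0 : ℂ)
    (hasDerivAt_conj_exp C X)
  refine h1.unique ((hasDerivAt_conj_exp (φ.differential C)
    (φ.differential X)).congr_of_eventuallyEq (Filter.Eventually.of_forall fun t => ?_))
  refine (φ.differential_conj hG (exp_mem_matSet hG hC t) (exp_mem_matSet hG hC (-t))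
    (exp_smul_mul_exp_neg C t) hX).trans ?_
  rw [φ.mval_exp hG hC, φ.mval_exp hG hC]

/-! ### Absence of resonances on the Lie algebra -/

theorem mul_aeval_eq_aeval_mul {A B X : Mat N} (h : A * X = X * B) (q : Polynomial ℂ) :
    Polynomial.aeval A q * X = X * Polynomial.aeval B q := by
  induction q using Polynomial.induction_on' with
  | add p q hp hq => rw [map_add, map_add, add_mul, mul_add, hp, hq]
  | monomial k a =>
    have : A ^ k * X = X * B ^ k := by
      induction k with
      | zero => simp
      | succ k ih => rw [pow_succ, mul_assoc, h, ← mul_assoc, ih, mul_assoc, pow_succ]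
    rw [Polynomial.aeval_monomial, Polynomial.aeval_monomial, mul_assoc, this, ← mul_assoc,
      Algebra.commutes, mul_assoc]

/-- If distinct eigenvalues of `A` do not differ by integers, then `ad A` has no nonzero integral
eigenvalue. -/
theorem eq_zero_of_resonance (hN : 0 < N) {A X : Mat N} (hA : MatrixWeaklyPrepared A) {j : ℤ}
    (hj : j ≠ 0) (h : A * X - X * A = (j : ℂ) • X) : X = 0 := by
  have : Nonempty (Fin N) := ⟨⟨0, hN⟩⟩
  have h1 : A * X = X * (A + algebraMap ℂ (Mat N) j) := by
    rw [mul_add, ← Algebra.commutes, ← Algebra.smul_def, ← h]; abel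
  have h2 := mul_aeval_eq_aeval_mul h1 A.charpoly
  rw [Matrix.aeval_self_charpoly, zero_mul] at h2
  have h3 : IsUnit (Polynomial.aeval (A + algebraMap ℂ (Mat N) j) A.charpoly) := by
    rw [← spectrum.zero_notMem_iff ℂ, spectrum.map_polynomial_aeval_of_degree_pos]
    · rintro ⟨μ, hμ, hμ'⟩
      have h4 : μ ∈ spectrum ℂ A := Matrix.mem_spectrum_of_isRoot_charpoly hμ'
      have h5 : μ - j ∈ spectrum ℂ A := by
        rw [spectrum.mem_iff] at hμ ⊢
        rwa [map_sub, sub_sub, add_comm _ A]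
      refine hA μ h4 _ h5 ?_ j (by ring)
      intro h6
      have : (j : ℂ) = 0 := by linear_combination h6
      exact hj (by exact_mod_cast this)
    · rw [Matrix.charpoly_degree_eq_dim]
      simpa using hN
  exact (h3.mul_left_eq_zero).1 h2.symm

/-- The gauge equation can be solved in the Lie algebra in every order. -/
theorem exists_gauge_coefficient (hG : IsAlgebraic G) {C : Mat n} (hC : C ∈ lieAlg G)
    (hprep : WeaklyPrepared G C) {j : ℤ} (hj : j ≠ 0) {Y : Mat n} (hY : Y ∈ lieAlg G) :
    ∃ X ∈ lieAlg G, (j : ℂ) • X + (C * X - X * C) = Y := by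
  obtain ⟨N, hN, φ, hφ, hprep⟩ := hprep
  let L : lieSub G →ₗ[ℂ] lieSub G :=
    { toFun := fun X => ⟨(j : ℂ) • X.1 + (C * X.1 - X.1 * C),
        (lieSub G).add_mem ((lieSub G).smul_mem _ X.2) (bracket_mem_lieAlg hG hC X.2)⟩
      map_add' := fun X Y => Subtype.ext (by
        simp only [Submodule.coe_add, smul_add, mul_add, add_mul]; abel)
      map_smul' := fun a X => Subtype.ext (by
        simp only [Submodule.coe_smul, Matrix.mul_smul, Matrix.smul_mul, RingHom.id_apply,
          smul_add, smul_sub, smul_comm a (j : ℂ)]) }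
  have hL : Function.Injective L := by
    refine (injective_iff_map_eq_zero L).2 fun X hX => Subtype.ext ?_
    have h1 : (j : ℂ) • X.1 + (C * X.1 - X.1 * C) = 0 := congrArg Subtype.val hX
    refine φ.eq_zero_of_differential hG hφ X.2 (eq_zero_of_resonance hN hprep (neg_ne_zero.2 hj) ?_)
    rw [← φ.differential_bracket hG hC X.2, eq_neg_of_add_eq_zero_right h1]
    have := map_smul φ.differentialₗ (-(j : ℂ)) X.1
    rw [neg_smul] at this
    rw [Int.cast_neg]
    exact this
  obtain ⟨X, hX⟩ := LinearMap.surjective_of_injective hL ⟨Y, hY⟩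
  exact ⟨X.1, X.2, congrArg Subtype.val hX⟩

end

section

variable {n : ℕ} {G : Subgroup (GL (Fin n) ℂ)}

open NormedSpace (exp)

/-! ### Nilpotent and unipotent matrices -/

theorem exists_eigenvector {A : Mat n} {μ : ℂ} (h : μ ∈ spectrum ℂ A) :
    ∃ v : Fin n → ℂ, v ≠ 0 ∧ A *ᵥ v = μ • v := by
  have h1 : (algebraMap ℂ (Mat n) μ - A).det = 0 := by
    by_contra h2
    exact h ((Matrix.isUnit_iff_isUnit_det _).2 (Ne.isUnit h2))
  obtain ⟨v, hv, h2⟩ := Matrix.exists_mulVec_eq_zero_iff.2 h1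
  refine ⟨v, hv, ?_⟩
  rw [Matrix.sub_mulVec, sub_eq_zero, Matrix.algebraMap_eq_diagonal] at h2
  rw [← h2]
  ext i
  simp [Matrix.mulVec_diagonal]

theorem mem_spectrum_of_mulVec {A : Mat n} {μ : ℂ} {v : Fin n → ℂ} (hv : v ≠ 0)
    (h : A *ᵥ v = μ • v) : μ ∈ spectrum ℂ A := by
  intro hu
  refine hv ?_
  have h1 : (algebraMap ℂ (Mat n) μ - A) *ᵥ v = 0 := by
    rw [Matrix.sub_mulVec, h, sub_eq_zero, Matrix.algebraMap_eq_diagonal]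
    ext i
    simp [Matrix.mulVec_diagonal]
  obtain ⟨u, hu⟩ := hu
  rw [← hu] at h1
  calc v = ((u⁻¹ : (Mat n)ˣ) * u : Mat n) *ᵥ v := by simp
    _ = 0 := by rw [← Matrix.mulVec_mulVec, h1, Matrix.mulVec_zero]

theorem pow_mulVec {A : Mat n} {μ : ℂ} {v : Fin n → ℂ} (h : A *ᵥ v = μ • v) (m : ℕ) :
    (A ^ m) *ᵥ v = μ ^ m • v := by
  induction m with
  | zero => simp
  | succ m ih => rw [pow_succ, ← Matrix.mulVec_mulVec, h, Matrix.mulVec_smul, ih, smul_smul, pow_succ,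
      mul_comm]

theorem isNilpotent_iff_spectrum {A : Mat n} : IsNilpotent A ↔ ∀ μ ∈ spectrum ℂ A, μ = 0 := by
  constructor
  · rintro ⟨k, hk⟩ μ hμ
    obtain ⟨v, hv, h⟩ := exists_eigenvector hμ
    have h1 := pow_mulVec h k
    rw [hk, Matrix.zero_mulVec] at h1
    exact eq_zero_of_pow_eq_zero ((smul_eq_zero.1 h1.symm).resolve_right hv)
  · intro h
    have h1 : A.charpoly.roots = Multiset.replicate (Multiset.card A.charpoly.roots) 0 :=
      Multiset.eq_replicate_card.2 fun μ hμ =>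
        h μ (Matrix.mem_spectrum_of_isRoot_charpoly (Polynomial.isRoot_of_mem_roots hμ))
    have h2 := (IsAlgClosed.splits A.charpoly).eq_prod_roots_of_monic A.charpoly_monic
    rw [h1] at h2
    have h3 := A.aeval_self_charpoly
    rw [h2] at h3
    exact ⟨_, by simpa using h3⟩

theorem isNilpotent_sub_one_iff {A : Mat n} :
    IsNilpotent (A - 1) ↔ ∀ μ ∈ spectrum ℂ A, μ = 1 := by
  rw [isNilpotent_iff_spectrum]
  have e (μ : ℂ) : μ ∈ spectrum ℂ (A - 1) ↔ μ + 1 ∈ spectrum ℂ A := by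
    rw [spectrum.mem_iff, spectrum.mem_iff, map_add, map_one, sub_sub_eq_add_sub]
  simp only [e]
  refine ⟨fun h μ hμ => ?_, fun h μ hμ => by simpa using h _ hμ⟩
  have := h (μ - 1) (by simpa using hμ)
  linear_combination this

/-! ### Polynomial curves of matrices -/

/-- The polynomial functions on `ℂ`. -/
def polyFun : Subalgebra ℂ (ℂ → ℂ) := (Polynomial.aeval (id : ℂ → ℂ)).range

theorem mem_polyFun {f : ℂ → ℂ} : f ∈ polyFun ↔ ∃ q : Polynomial ℂ, ∀ t, f t = q.eval t := by
  have e (q : Polynomial ℂ) (t : ℂ) : (Polynomial.aeval (id : ℂ → ℂ) q) t = q.eval t := by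
    induction q using Polynomial.induction_on' with
    | add p q hp hq => rw [map_add, Pi.add_apply, hp, hq, Polynomial.eval_add]
    | monomial k a => simp [Polynomial.aeval_monomial]
  constructor
  · rintro ⟨q, rfl⟩
    exact ⟨q, e q⟩
  · rintro ⟨q, hq⟩
    exact ⟨q, funext fun t => (e q t).trans (hq t).symm⟩

theorem eval_mem_polyFun (q : Polynomial ℂ) : (fun t => q.eval t) ∈ polyFun :=
  mem_polyFun.2 ⟨q, fun _ => rfl⟩

theorem const_mem_polyFun (a : ℂ) : (fun _ => a) ∈ polyFun :=
  mem_polyFun.2 ⟨Polynomial.C a, fun _ => by simp⟩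

/-- Polynomial functions are determined by their values at the natural numbers. -/
theorem polyFun_ext {f g : ℂ → ℂ} (hf : f ∈ polyFun) (hg : g ∈ polyFun)
    (h : ∀ m : ℕ, f m = g m) (t : ℂ) : f t = g t := by
  obtain ⟨p, hp⟩ := mem_polyFun.1 hf
  obtain ⟨q, hq⟩ := mem_polyFun.1 hg
  have : p = q := by
    refine Polynomial.eq_of_infinite_eval_eq p q ?_
    refine (Set.infinite_range_of_injective (Nat.cast_injective (R := ℂ))).mono ?_
    rintro _ ⟨m, rfl⟩
    change p.eval (m : ℂ) = q.eval (m : ℂ)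
    rw [← hp, ← hq, h m]
  rw [hp, hq, this]

theorem polyFun_comp {f : ℂ → ℂ} (hf : f ∈ polyFun) (a b : ℂ) :
    (fun t => f (a + b * t)) ∈ polyFun := by
  obtain ⟨p, hp⟩ := mem_polyFun.1 hf
  refine mem_polyFun.2 ⟨p.comp (Polynomial.C a + Polynomial.C b * Polynomial.X), fun t => ?_⟩
  simp [hp]

/-- A number whose powers depend polynomially on the exponent equals `1`. -/
theorem eq_one_of_pow_polyFun {a : ℂ} {f : ℂ → ℂ} (hf : f ∈ polyFun)
    (h : ∀ m : ℕ, f m = a ^ m) : a = 1 := by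
  obtain ⟨p, hp⟩ := mem_polyFun.1 hf
  have h1 : p.comp (Polynomial.X + Polynomial.C 1) = Polynomial.C a * p := by
    refine Polynomial.eq_of_infinite_eval_eq _ _ ?_
    refine (Set.infinite_range_of_injective (Nat.cast_injective (R := ℂ))).mono ?_
    rintro _ ⟨m, rfl⟩
    have h2 := h (m + 1)
    have h3 := h m
    rw [hp] at h2 h3
    push_cast at h2
    simp [h2, h3, pow_succ, mul_comm]
  have h0 : p ≠ 0 := by
    rintro rfl
    have := h 0
    simp [hp] at this
  have h4 := congrArg Polynomial.leadingCoeff h1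
  rw [Polynomial.leadingCoeff_comp (by rw [Polynomial.natDegree_X_add_C]; exact one_ne_zero),
    Polynomial.leadingCoeff_mul] at h4
  simp only [Polynomial.leadingCoeff_X_add_C, one_pow, mul_one, Polynomial.leadingCoeff_C] at h4
  have h5 : p.leadingCoeff ≠ 0 := Polynomial.leadingCoeff_ne_zero.2 h0
  exact mul_right_cancel₀ h5 (by rw [one_mul]; exact h4.symm)

/-- A curve of matrices with polynomial entries. -/
def PolyCurve (A : ℂ → Mat n) : Prop := ∀ i j, (fun t => A t i j) ∈ polyFun

theorem PolyCurve.const_mul {U : ℂ → Mat n} (hU : PolyCurve U) (A : Mat n) :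
    PolyCurve fun t => A * U t := by
  intro i j
  have e : (fun t => (A * U t) i j) = ∑ k, A i k • fun t => U t k j := by
    funext t; simp [Matrix.mul_apply]
  rw [e]
  exact Subalgebra.sum_mem _ fun k _ => polyFun.smul_mem (hU k j) _

theorem PolyCurve.det {U : ℂ → Mat n} (hU : PolyCurve U) : (fun t => (U t).det) ∈ polyFun := by
  have e : (fun t => (U t).det) =
      ∑ σ : Equiv.Perm (Fin n), ((Equiv.Perm.sign σ : ℤ) : ℂ) • ∏ i, fun t => U t (σ i) i := by
    funext t; simp [Matrix.det_apply']
  rw [e]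
  exact Subalgebra.sum_mem _ fun σ _ => polyFun.smul_mem
    (Subalgebra.prod_mem _ fun i _ => hU (σ i) i) _

theorem PolyCurve.mulVec {U : ℂ → Mat n} (hU : PolyCurve U) (v : Fin n → ℂ) (i : Fin n) :
    (fun t => (U t *ᵥ v) i) ∈ polyFun := by
  have e : (fun t => (U t *ᵥ v) i) = ∑ j, v j • fun t => U t i j := by
    funext t; simp [Matrix.mulVec, dotProduct, mul_comm]
  rw [e]
  exact Subalgebra.sum_mem _ fun k _ => polyFun.smul_mem (hU i k) _

/-- A regular function is polynomial along a polynomial curve with constant determinant. -/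
theorem PolyCurve.val {U : ℂ → Mat n} (hU : PolyCurve U) {d : ℂ} (hd : ∀ t, (U t).det = d)
    (p : Reg n) : (fun t => p.val (U t)) ∈ polyFun := by
  induction p using MvPolynomial.induction_on with
  | C a => simpa using const_mem_polyFun a
  | add p q hp hq =>
    simp only [val_add]
    exact polyFun.add_mem hp hq
  | mul_X p c hp =>
    have hc : (fun t => coords (U t) c) ∈ polyFun := by
      rcases c with _ | ij
      · simpa only [coords, hd] using const_mem_polyFun d⁻¹
      · exact hU ij.1 ij.2
    simp only [val_mul, val_X]
    exact polyFun.mul_mem hp hc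

theorem PolyCurve.ext {U V : ℂ → Mat n} (hU : PolyCurve U) (hV : PolyCurve V)
    (h : ∀ m : ℕ, U m = V m) (t : ℂ) : U t = V t := by
  ext i j
  exact polyFun_ext (hU i j) (hV i j) (fun m => by rw [h]) t

/-- `U` is a polynomial curve that interpolates the powers of `u`. -/
def IsPowerCurve (u : Mat n) (U : ℂ → Mat n) : Prop := PolyCurve U ∧ ∀ m : ℕ, U m = u ^ m

theorem IsPowerCurve.det {u : Mat n} {U : ℂ → Mat n} (hU : IsPowerCurve u U) (t : ℂ) :
    (U t).det = 1 := by
  have h1 : u.det = 1 :=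
    eq_one_of_pow_polyFun hU.1.det fun m => by rw [hU.2, Matrix.det_pow]
  exact polyFun_ext hU.1.det (const_mem_polyFun 1) (fun m => by simp [hU.2, h1]) t

/-- A matrix whose powers depend polynomially on the exponent is unipotent. -/
theorem IsPowerCurve.isNilpotent {u : Mat n} {U : ℂ → Mat n} (hU : IsPowerCurve u U) :
    IsNilpotent (u - 1) := by
  refine isNilpotent_sub_one_iff.2 fun μ hμ => ?_
  obtain ⟨v, hv, h⟩ := exists_eigenvector hμ
  obtain ⟨i, hi⟩ := Function.ne_iff.1 hv
  refine eq_one_of_pow_polyFun (polyFun.smul_mem (hU.1.mulVec v i) (v i)⁻¹) fun m => ?_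
  have h1 := congrFun (pow_mulVec h m) i
  simp only [Pi.smul_apply, smul_eq_mul] at h1 ⊢
  rw [hU.2, h1, mul_comm, mul_assoc, mul_inv_cancel₀ hi, mul_one]

theorem exists_isPowerCurve {u : Mat n} (hu : IsNilpotent (u - 1)) :
    ∃ U, IsPowerCurve u U := by
  obtain ⟨k, hk⟩ := hu
  refine ⟨fun t => ∑ i ∈ Finset.range k,
    (((i.factorial : ℂ)⁻¹) * (descPochhammer ℂ i).eval t) • (u - 1) ^ i, fun a b => ?_, fun m => ?_⟩
  · have e : (fun t => (∑ i ∈ Finset.range k,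
        (((i.factorial : ℂ)⁻¹) * (descPochhammer ℂ i).eval t) • (u - 1) ^ i) a b) =
        ∑ i ∈ Finset.range k, ((((u - 1) ^ i) a b) * (i.factorial : ℂ)⁻¹) •
          fun t => (descPochhammer ℂ i).eval t := by
      funext t
      simp only [Matrix.sum_apply, Matrix.smul_apply, Finset.sum_apply, Pi.smul_apply, smul_eq_mul]
      exact Finset.sum_congr rfl fun i _ => by ring
    rw [e]
    exact Subalgebra.sum_mem _ fun i _ => polyFun.smul_mem (eval_mem_polyFun _) _
  · have e (i : ℕ) : ((i.factorial : ℂ)⁻¹) * (descPochhammer ℂ i).eval (m : ℂ) = (m.choose i : ℂ) := by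
      rw [descPochhammer_eval_eq_descFactorial, Nat.descFactorial_eq_factorial_mul_choose]
      have : (i.factorial : ℂ) ≠ 0 := by exact_mod_cast i.factorial_ne_zero
      push_cast
      field_simp
    simp only [e]
    have h1 : u ^ m = ∑ i ∈ Finset.range (m + 1), (m.choose i : ℂ) • (u - 1) ^ i := by
      conv_lhs => rw [← sub_add_cancel u 1, (Commute.one_right (u - 1)).add_pow]
      refine Finset.sum_congr rfl fun i _ => ?_
      rw [one_pow, mul_one, ← Nat.cast_comm, ← nsmul_eq_mul, Nat.cast_smul_eq_nsmul]
    rw [h1]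
    -- both sums agree with the one over the larger range
    have h2 : ∀ K, k ≤ K → ∑ i ∈ Finset.range k, (m.choose i : ℂ) • (u - 1) ^ i =
        ∑ i ∈ Finset.range K, (m.choose i : ℂ) • (u - 1) ^ i := fun K hK =>
      Finset.sum_subset (Finset.range_mono hK) fun i _ hi => by
        rw [pow_eq_zero_of_le (by simpa using hi) hk, smul_zero]
    have h3 : ∀ K, m + 1 ≤ K → ∑ i ∈ Finset.range (m + 1), (m.choose i : ℂ) • (u - 1) ^ i =
        ∑ i ∈ Finset.range K, (m.choose i : ℂ) • (u - 1) ^ i := fun K hK =>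
      Finset.sum_subset (Finset.range_mono hK) fun i _ hi => by
        rw [Nat.choose_eq_zero_of_lt (by simpa using hi), Nat.cast_zero, zero_smul]
    rw [h2 _ (le_max_left k (m + 1)), h3 _ (le_max_right k (m + 1))]

theorem isNilpotent_exp_sub_one {A : Mat n} (hA : IsNilpotent A) : IsNilpotent (exp A - 1) := by
  obtain ⟨k, hk⟩ := hA
  have e (t : ℂ) : exp (t • A) = ∑ i ∈ Finset.range k, ((i.factorial : ℂ)⁻¹ * t ^ i) • A ^ i := by
    rw [NormedSpace.exp_eq_tsum ℂ]
    beta_reduce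
    rw [tsum_eq_sum (s := Finset.range k)]
    · exact Finset.sum_congr rfl fun i _ => by rw [smul_pow, smul_smul]
    · intro i hi
      rw [smul_pow, pow_eq_zero_of_le (by simpa using hi) hk, smul_zero, smul_zero]
  refine IsPowerCurve.isNilpotent (U := fun t : ℂ => exp (t • A)) ⟨fun a b => ?_, fun m => ?_⟩
  · have e' : (fun t : ℂ => exp (t • A) a b) = ∑ i ∈ Finset.range k,
        ((A ^ i) a b * (i.factorial : ℂ)⁻¹) • fun t => (Polynomial.X ^ i : Polynomial ℂ).eval t := by
      funext t
      simp only [e, Matrix.sum_apply, Matrix.smul_apply, Finset.sum_apply, Pi.smul_apply,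
        smul_eq_mul, Polynomial.eval_pow, Polynomial.eval_X]
      exact Finset.sum_congr rfl fun i _ => by ring
    rw [e']
    exact Subalgebra.sum_mem _ fun i _ => polyFun.smul_mem (eval_mem_polyFun _) _
  · beta_reduce
    rw [Nat.cast_smul_eq_nsmul, Matrix.exp_nsmul]

end

section

variable {n : ℕ} {G : Subgroup (GL (Fin n) ℂ)}

open NormedSpace (exp)

/-! ### Nilpotency of the residue and unipotency of the monodromy -/

theorem mem_spectrum_exp {A : Mat n} {μ : ℂ} (h : μ ∈ spectrum ℂ A) (t : ℂ) :
    Complex.exp (t * μ) ∈ spectrum ℂ (exp (t • A)) := by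
  obtain ⟨v, hv, h⟩ := exists_eigenvector h
  have h1 : t * μ ∈ spectrum ℂ (t • A) :=
    mem_spectrum_of_mulVec hv (by rw [Matrix.smul_mulVec, h, smul_smul])
  rw [Complex.exp_eq_exp_ℂ]
  exact spectrum.exp_mem_exp _ h1

theorem eq_intCast_of_unipotent {A : Mat n}
    (h : IsNilpotent (exp ((-(2 * (Real.pi : ℂ) * Complex.I)) • A) - 1)) {μ : ℂ}
    (hμ : μ ∈ spectrum ℂ A) : ∃ k : ℤ, μ = k := by
  have h1 := isNilpotent_sub_one_iff.1 h _ (mem_spectrum_exp hμ _)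
  obtain ⟨k, hk⟩ := Complex.exp_eq_one_iff.1 h1
  refine ⟨-k, ?_⟩
  have h2 : (2 * (Real.pi : ℂ) * Complex.I) ≠ 0 := Complex.two_pi_I_ne_zero
  refine mul_left_cancel₀ h2 ?_
  push_cast
  linear_combination -hk

/-- Morphisms of algebraic groups carry power curves to power curves. -/
theorem IsPowerCurve.mval {u : Mat n} {U : ℂ → Mat n} (hU : IsPowerCurve u U)
    (hu : u ∈ matSet G) {N : ℕ} (φ : RegularHom G N) :
    IsPowerCurve (φ.mval u) fun t => φ.mval (U t) :=
  ⟨fun k l => hU.1.val hU.det (φ.entry k l), fun m => by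
    simp only [hU.2, (φ.mval_pow hu m).2]⟩

theorem isNilpotent_mval_sub_one {u : Mat n} (hu : u ∈ matSet G) (h : IsNilpotent (u - 1)) {N : ℕ}
    (φ : RegularHom G N) : IsNilpotent (φ.mval u - 1) := by
  obtain ⟨U, hU⟩ := exists_isPowerCurve h
  exact (hU.mval hu φ).isNilpotent

/-- If a power `g ^ m` is unipotent and `φ` is injective with `φ(g)` unipotent, then `1` is the
only eigenvalue of `g` whose `m`-th power is `1`. The reason is that `G` contains the product of
`g` with the unipotent `m`-th root of `g ^ (-m)`, and `φ` maps this product to `1`. -/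
theorem eq_one_of_pow_unipotent (hG : IsAlgebraic G) {N : ℕ} {φ : RegularHom G N}
    (hφ : Function.Injective φ.toHom) {g : Mat n} (hg : g ∈ matSet G) {m : ℕ} (hm : m ≠ 0)
    (hu : IsNilpotent (g ^ m - 1)) (hq : IsNilpotent (φ.mval g - 1)) {ζ : ℂ}
    (hζ : ζ ∈ spectrum ℂ g) (hζm : ζ ^ m = 1) : ζ = 1 := by
  obtain ⟨U, hU⟩ := exists_isPowerCurve hu
  obtain ⟨Q, hQ⟩ := exists_isPowerCurve hq
  have hgm := (φ.mval_pow hg m).1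
  have hdet (t : ℂ) : (g * U t).det = g.det := by rw [Matrix.det_mul, hU.det, mul_one]
  have hS : PolyCurve fun t => g * U t := hU.1.const_mul g
  have hSm (j : ℕ) : g * U j = g ^ (1 + m * j) := by rw [hU.2, pow_add, pow_one, pow_mul]
  -- Zariski closedness: the curve is in `G` at natural numbers
  have hSG (t : ℂ) : g * U t ∈ matSet G := by
    refine mem_matSet_of_vanishing hG ?_ fun p hp => ?_
    · rw [hdet]; exact isUnit_det_of_mem_matSet hg
    · refine polyFun_ext (hS.val hdet p) (const_mem_polyFun 0) (fun j => ?_) t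
      rw [hSm]
      exact hp _ (φ.mval_pow hg _).1
  have hSQ (t : ℂ) : φ.mval (g * U t) = Q (1 + m * t) := by
    refine PolyCurve.ext (U := fun t => φ.mval (g * U t)) (V := fun t => Q (1 + m * t))
      (fun k l => hS.val hdet (φ.entry k l))
      (fun k l => polyFun_comp (hQ.1 k l) 1 m) (fun j => ?_) t
    have := hQ.2 (1 + m * j)
    push_cast at this
    rw [hSm, this, (φ.mval_pow hg _).2]
  have hm' : (m : ℂ) ≠ 0 := by exact_mod_cast hm
  have h1 : g * U (-(m : ℂ)⁻¹) = 1 := by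
    refine φ.eq_one_of_mval hφ (hSG _) ?_
    have h2 := hQ.2 0
    rw [hSQ, mul_neg, mul_inv_cancel₀ hm', add_neg_cancel]
    simpa using h2
  obtain ⟨v, hv, h⟩ := exists_eigenvector hζ
  have h2 (t : ℂ) : U t *ᵥ v = v := by
    funext i
    refine polyFun_ext (hU.1.mulVec v i) (const_mem_polyFun (v i)) (fun j => ?_) t
    rw [hU.2, ← pow_mul, pow_mulVec h, pow_mul, hζm, one_pow, one_smul]
  have h3 : (g * U (-(m : ℂ)⁻¹)) *ᵥ v = ζ • v := by rw [← Matrix.mulVec_mulVec, h2, h]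
  rw [h1, Matrix.one_mulVec] at h3
  have h4 : (1 - ζ) • v = 0 := by rw [sub_smul, one_smul, ← h3, sub_self]
  exact (sub_eq_zero.1 ((smul_eq_zero.1 h4).resolve_right hv)).symm

/-- An element of the Lie algebra with nilpotent image under the differential of an injective
morphism is nilpotent, provided that `exp(-2πiC)` is unipotent, that is, that the eigenvalues of `C`
are integers. -/
theorem isNilpotent_of_differential (hG : IsAlgebraic G) {N : ℕ} {φ : RegularHom G N}
    (hφ : Function.Injective φ.toHom) {C : Mat n} (hC : C ∈ lieAlg G)
    (hT : IsNilpotent (exp ((-(2 * (Real.pi : ℂ) * Complex.I)) • C) - 1))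
    (hn : IsNilpotent (φ.differential C)) : IsNilpotent C := by
  refine isNilpotent_iff_spectrum.2 fun μ hμ => ?_
  obtain ⟨k, rfl⟩ := eq_intCast_of_unipotent hT hμ
  by_contra hk
  have hk' : (k.natAbs : ℂ) ≠ 0 := by
    intro h
    have : k.natAbs = 0 := by exact_mod_cast h
    exact hk (by simpa using this)
  -- for this exponent the eigenvalue of `exp(-2πi C / m)` that comes from `k` is `-1`
  set m : ℕ := 2 * k.natAbs with hm
  have hm0 : m ≠ 0 := by
    intro h
    have : k.natAbs = 0 := by omega
    exact hk' (by rw [this, Nat.cast_zero])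
  have hm0' : (m : ℂ) ≠ 0 := by exact_mod_cast hm0
  set c : ℂ := -(2 * (Real.pi : ℂ) * Complex.I) with hc
  have hg := exp_mem_matSet hG hC ((m : ℂ)⁻¹ * c)
  have hgm : exp (((m : ℂ)⁻¹ * c) • C) ^ m = exp (c • C) := by
    rw [← Matrix.exp_nsmul, ← Nat.cast_smul_eq_nsmul ℂ, smul_smul, ← mul_assoc,
      mul_inv_cancel₀ hm0', one_mul]
  have hq : IsNilpotent (φ.mval (exp (((m : ℂ)⁻¹ * c) • C)) - 1) := by
    rw [φ.mval_exp hG hC]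
    exact isNilpotent_exp_sub_one (hn.smul _)
  have hζ := mem_spectrum_exp hμ ((m : ℂ)⁻¹ * c)
  have h1 := eq_one_of_pow_unipotent hG hφ hg hm0 (by rwa [hgm]) hq hζ (by
    rw [← Complex.exp_nat_mul, ← mul_assoc, ← mul_assoc, mul_inv_cancel₀ hm0', one_mul,
      Complex.exp_eq_one_iff]
    exact ⟨-k, by rw [hc]; push_cast; ring⟩)
  obtain ⟨j, hj⟩ := Complex.exp_eq_one_iff.1 h1
  have h2 : -(k : ℂ) = j * m := by
    refine mul_left_cancel₀ Complex.two_pi_I_ne_zero ?_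
    have : (m : ℂ)⁻¹ * m = 1 := inv_mul_cancel₀ hm0'
    calc 2 * (Real.pi : ℂ) * Complex.I * -(k : ℂ) = ((m : ℂ)⁻¹ * m) * (c * k) := by
          rw [this, hc]; ring
      _ = ((m : ℂ)⁻¹ * c * k) * m := by ring
      _ = _ := by rw [hj]; ring
  have h3 : -k = j * (m : ℤ) := by exact_mod_cast h2
  have h4 : (m : ℤ) ∣ k := by rw [← dvd_neg]; exact ⟨j, by rw [h3, mul_comm]⟩
  have h5 := Int.natAbs_dvd_natAbs.2 h4
  have h6 := Nat.le_of_dvd (by omega) h5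
  simp only [Int.natAbs_natCast] at h6
  omega

theorem val_det {N : ℕ} (M : Matrix (Fin N) (Fin N) (Reg n)) (A : Mat n) :
    Reg.val M.det A = (Matrix.of fun k l => (M k l).val A).det := by
  simp [Matrix.det_apply', Reg.val, map_sum, map_prod]

/-- If `G` has no characters, then the differentials of its morphisms are traceless, because the
determinant of such a morphism is a character. -/
theorem trace_differential_eq_zero (hG : IsAlgebraic G) (h : NoCharacters G) {N : ℕ}
    (φ : RegularHom G N) {X : Mat n} (hX : X ∈ lieAlg G) : (φ.differential X).trace = 0 := by
  let χ : RegularHom G 1 :=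
    { toHom := (Units.map (algebraMap ℂ (Mat 1)).toMonoidHom).comp
        (Matrix.GeneralLinearGroup.det.comp φ.toHom)
      entry := fun _ _ => (Matrix.of φ.entry).det
      entry_val := fun g k l => by
        have e : Reg.val (Matrix.of φ.entry).det ((g : GL (Fin n) ℂ) : Mat n) =
            (φ.toHom g : Mat N).det := by
          rw [← φ.mval_coe]
          exact val_det _ _
        rw [e, Subsingleton.elim l k]
        simp [Matrix.algebraMap_matrix_apply] }
  have hdet {A : Mat n} (hA : A ∈ matSet G) : (φ.mval A).det = 1 := by
    obtain ⟨g, hg, rfl⟩ := hA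
    have h1 := χ.entry_val ⟨g, hg⟩ 0 0
    rw [h χ] at h1
    have h2 : Reg.val (Matrix.of φ.entry).det (g : Mat n) = (φ.mval (g : Mat n)).det :=
      val_det _ _
    rw [← h2]
    exact h1.symm
  have h1 := hasDerivAt_det (hasDerivAt_exp_smul (φ.differential X) 0)
  have h2 := h1.unique ((hasDerivAt_const (0 : ℂ) (1 : ℂ)).congr_of_eventuallyEq
    (Filter.Eventually.of_forall fun t => by
      beta_reduce
      rw [← φ.mval_exp hG hX, hdet (exp_mem_matSet hG hX t)]))
  simpa using h2

/-- If `exp(-2πiC)` is unipotent, then the eigenvalues of `dφ(C)` are integers, and hence all equal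
if distinct ones do not differ by integers. -/
theorem exists_forall_spectrum_eq (hG : IsAlgebraic G) {N : ℕ} (hN : 0 < N) {φ : RegularHom G N}
    {C : Mat n} (hC : C ∈ lieAlg G) (hw : MatrixWeaklyPrepared (φ.differential C))
    (hT : IsNilpotent (exp ((-(2 * (Real.pi : ℂ) * Complex.I)) • C) - 1)) :
    ∃ k : ℤ, (k : ℂ) ∈ spectrum ℂ (φ.differential C) ∧
      ∀ μ ∈ spectrum ℂ (φ.differential C), μ = k := by
  have : Nonempty (Fin N) := ⟨⟨0, hN⟩⟩
  have h1 := isNilpotent_mval_sub_one (exp_mem_matSet hG hC _) hT φ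
  rw [φ.mval_exp hG hC] at h1
  obtain ⟨μ, hμ⟩ := spectrum.nonempty_of_isAlgClosed_of_finiteDimensional ℂ (φ.differential C)
  obtain ⟨k, rfl⟩ := eq_intCast_of_unipotent h1 hμ
  refine ⟨k, hμ, fun ν hν => ?_⟩
  obtain ⟨l, rfl⟩ := eq_intCast_of_unipotent h1 hν
  by_contra hne
  exact hw _ hν _ hμ hne (l - k) (by push_cast; rfl)

theorem isNilpotent_iff_exp (hG : IsAlgebraic G) {C : Mat n} (hC : C ∈ lieAlg G)
    (hprep : WeaklyPrepared G C) (h : Prepared G C ∨ NoCharacters G) :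
    IsNilpotent C ↔ IsNilpotent (exp ((-(2 * (Real.pi : ℂ) * Complex.I)) • C) - 1) := by
  refine ⟨fun hn => isNilpotent_exp_sub_one (hn.smul _), fun hT => ?_⟩
  rcases h with h | h
  · obtain ⟨N, hN, φ, hφ, hw, h0⟩ := h
    obtain ⟨k, hk, hall⟩ := exists_forall_spectrum_eq hG hN hC hw hT
    obtain rfl := h0 k hk
    exact isNilpotent_of_differential hG hφ hC hT
      (isNilpotent_iff_spectrum.2 fun μ hμ => by simpa using hall μ hμ)
  · obtain ⟨N, hN, φ, hφ, hw⟩ := hprep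
    obtain ⟨k, hk, hall⟩ := exists_forall_spectrum_eq hG hN hC hw hT
    have h1 : IsNilpotent (φ.differential C - algebraMap ℂ (Mat N) k) := by
      refine isNilpotent_iff_spectrum.2 fun μ hμ => ?_
      have : μ + k ∈ spectrum ℂ (φ.differential C) := by
        rw [spectrum.mem_iff] at hμ ⊢
        rw [sub_sub_eq_add_sub] at hμ
        rwa [map_add]
      have := hall _ this
      linear_combination this
    have h2 := (Matrix.isNilpotent_trace_of_isNilpotent h1).eq_zero
    rw [Matrix.trace_sub, trace_differential_eq_zero hG h φ hC, Matrix.algebraMap_eq_diagonal] at h2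
    have h3 : (k : ℂ) = 0 := by
      have hN' : (N : ℂ) ≠ 0 := by exact_mod_cast hN.ne'
      simpa [Matrix.trace_diagonal, hN'] using h2
    exact isNilpotent_of_differential hG hφ hC hT
      (isNilpotent_iff_spectrum.2 fun μ hμ => by rw [hall μ hμ, h3])

end

section

variable {n : ℕ} {G : Subgroup (GL (Fin n) ℂ)}

open NormedSpace (exp)
open Metric (ball)

/-! ### Linear differential equations on a disc -/

/-- A linear differential equation with holomorphic coefficients has a holomorphic fundamental
solution near every point. It is the sum of the series of iterated primitives, which converges
geometrically on a small disc. -/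
theorem exists_fundamental_solution {x : ℂ} {r : ℝ} (hr : 0 < r) {B : ℂ → Mat n}
    (hB : DifferentiableOn ℂ B (ball x r)) :
    ∃ ε, 0 < ε ∧ ε ≤ r ∧ ∃ h : ℂ → Mat n, h x = 1 ∧
      ∀ z ∈ ball x ε, HasDerivAt h (B z * h z) z := by
  set K : ℝ := ‖B x‖ + 1 with hK
  have hK0 : 0 < K := by positivity
  have hcont : ContinuousAt B x :=
    (hB.differentiableAt (Metric.ball_mem_nhds x hr)).continuousAt
  obtain ⟨ε₀, hε₀, hbound⟩ := Metric.eventually_nhds_iff_ball.1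
    (hcont.norm.eventually_lt_const (show ‖B x‖ < K by rw [hK]; linarith))
  set ε : ℝ := min (min ε₀ r) (1 / (2 * K)) with hε
  have hε0 : 0 < ε := by positivity
  have hεr : ε ≤ r := (min_le_left _ _).trans (min_le_right _ _)
  have hεε₀ : ε ≤ ε₀ := (min_le_left _ _).trans (min_le_left _ _)
  have hεK : K * ε ≤ 1 / 2 := by
    have : ε ≤ 1 / (2 * K) := min_le_right _ _
    calc K * ε ≤ K * (1 / (2 * K)) := by gcongr
      _ = 1 / 2 := by field_simp
  have hBε : DifferentiableOn ℂ B (ball x ε) := hB.mono (Metric.ball_subset_ball hεr)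
  have hstep (f : {f : ℂ → Mat n // DifferentiableOn ℂ f (ball x ε)}) :
      ∃ g : {f : ℂ → Mat n // DifferentiableOn ℂ f (ball x ε)},
        g.1 x = 0 ∧ ∀ z ∈ ball x ε, HasDerivAt g.1 (B z * f.1 z) z := by
    obtain ⟨g, hg0, hg⟩ := (hBε.mul f.2).isExactOn_ball.with_val_at x 0
    exact ⟨⟨g, fun z hz => (hg z hz).differentiableAt.differentiableWithinAt⟩, hg0, hg⟩
  choose next hnext0 hnext using hstep
  let d : ℕ → {f : ℂ → Mat n // DifferentiableOn ℂ f (ball x ε)} :=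
    Nat.rec ⟨fun _ => 1, differentiableOn_const 1⟩ fun _ f => next f
  have hd0 (k : ℕ) : (d (k + 1)).1 x = 0 := hnext0 (d k)
  have hd (k : ℕ) : ∀ z ∈ ball x ε, HasDerivAt (d (k + 1)).1 (B z * (d k).1 z) z := hnext (d k)
  have hx : x ∈ ball x ε := Metric.mem_ball_self hε0
  have hle (k : ℕ) : ∀ z ∈ ball x ε, ‖(d k).1 z‖ ≤ ‖(1 : Mat n)‖ * (1 / 2) ^ k := by
    induction k with
    | zero => intro z _; simp [d]
    | succ k ih =>
      intro z hz
      have h1 := (convex_ball x ε).norm_image_sub_le_of_norm_hasDerivWithin_le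
        (C := K * (‖(1 : Mat n)‖ * (1 / 2) ^ k))
        (fun y hy => (hd k y hy).hasDerivWithinAt) (fun y hy => ?_) hx hz
      · rw [hd0, sub_zero] at h1
        have h2 : ‖z - x‖ ≤ ε := by
          rw [← dist_eq_norm]; exact (Metric.mem_ball.1 hz).le
        calc ‖(d (k + 1)).1 z‖ ≤ K * (‖(1 : Mat n)‖ * (1 / 2) ^ k) * ‖z - x‖ := h1
          _ ≤ K * (‖(1 : Mat n)‖ * (1 / 2) ^ k) * ε := by gcongr
          _ = (K * ε) * (‖(1 : Mat n)‖ * (1 / 2) ^ k) := by ring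
          _ ≤ (1 / 2) * (‖(1 : Mat n)‖ * (1 / 2) ^ k) := by gcongr
          _ = ‖(1 : Mat n)‖ * (1 / 2) ^ (k + 1) := by ring
      · refine (norm_mul_le _ _).trans ?_
        have h3 : ‖B y‖ ≤ K := (hbound y (Metric.ball_subset_ball hεε₀ hy)).le
        gcongr
        exact ih y hy
  have hsum : Summable fun k : ℕ => ‖(1 : Mat n)‖ * (1 / 2 : ℝ) ^ k :=
    (summable_geometric_of_lt_one (by norm_num) (by norm_num)).mul_left _
  refine ⟨ε, hε0, hεr, fun z => ∑' k, (d k).1 z, ?_, fun z hz => ?_⟩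
  · refine (tsum_eq_single 0 fun k hk => ?_).trans rfl
    obtain ⟨k, rfl⟩ := Nat.exists_eq_succ_of_ne_zero hk
    exact hd0 k
  · have h1 := Complex.hasSum_deriv_of_summable_norm hsum (fun k => (d k).2) Metric.isOpen_ball hle hz
    have h2 : DifferentiableAt ℂ (fun z => ∑' k, (d k).1 z) z :=
      (Complex.differentiableOn_tsum_of_summable_norm hsum (fun k => (d k).2) Metric.isOpen_ball
        hle).differentiableAt (Metric.isOpen_ball.mem_nhds hz)
    have h3 : HasSum (fun k => B z * (d k).1 z) (B z * ∑' k, (d k).1 z) :=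
      (Summable.of_norm_bounded hsum fun k => hle k z hz).hasSum.mul_left (B z)
    have h4 : (fun k => B z * (d k).1 z) = fun k => deriv (d (k + 1)).1 z :=
      funext fun k => (hd k z hz).deriv.symm
    rw [h4] at h3
    have h5 := (hasSum_nat_add_iff (f := fun k => deriv (d k).1 z) 1).1 h3
    have h6 : deriv (d 0).1 z = 0 := deriv_const z 1
    rw [Finset.sum_range_one, h6, add_zero] at h5
    rw [← h1.unique h5]
    exact h2.hasDerivAt

/-- If the coefficients lie in the Lie algebra of `G`, the fundamental solution lies in `G`. -/
theorem exists_fundamental_solution_mem (hG : IsAlgebraic G) {x : ℂ} {r : ℝ} (hr : 0 < r)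
    {B : ℂ → Mat n} (hB : DifferentiableOn ℂ B (ball x r)) (hBG : ∀ z ∈ ball x r, B z ∈ lieAlg G) :
    ∃ ε, 0 < ε ∧ ε ≤ r ∧ ∃ h : ℂ → Mat n, (∀ z ∈ ball x ε, h z ∈ matSet G) ∧
      ∀ z ∈ ball x ε, HasDerivAt h (B z * h z) z := by
  obtain ⟨ε, hε, hεr, h, hx, hh⟩ := exists_fundamental_solution hr hB
  have h1 : ContinuousAt (fun z => (h z).det) x :=
    (differentiable_det (h x)).continuousAt.comp (hh x (Metric.mem_ball_self hε)).continuousAt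
  obtain ⟨δ, hδ, hdet⟩ := Metric.eventually_nhds_iff_ball.1
    (h1.eventually_ne (show (h x).det ≠ 0 by simp [hx]))
  have hε' : min ε δ ≤ r := (min_le_left _ _).trans hεr
  have hh' : ∀ z ∈ ball x (min ε δ), HasDerivAt h (B z * h z) z := fun z hz =>
    hh z (Metric.ball_subset_ball (min_le_left _ _) hz)
  have hsub : ball x (min ε δ) ⊆ ball x r := Metric.ball_subset_ball hε'
  refine ⟨min ε δ, lt_min hε hδ, hε', h, ?_, hh'⟩
  exact mem_matSet_of_hasDerivAt hG Metric.isOpen_ball (convex_ball _ _).isPreconnected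
    (hB.mono hsub) (fun z hz => hBG z (hsub hz)) hh'
    (fun z hz => hdet z (Metric.ball_subset_ball (min_le_right _ _) hz))
    (Metric.mem_ball_self (lt_min hε hδ)) (by rw [hx]; exact one_mem_matSet)

/-! ### Estimates on a strip -/

/-- Grönwall's inequality along segments. -/
theorem norm_le_exp_mul_of_hasDerivAt {E : Type*} [NormedAddCommGroup E] [NormedSpace ℂ E]
    {Ω : Set ℂ} (hΩ : Convex ℝ Ω) {y y' : ℂ → E} (hy : ∀ w ∈ Ω, HasDerivAt y (y' w) w) {V : ℝ}
    (hV : ∀ w ∈ Ω, ‖y' w‖ ≤ V * ‖y w‖) {w₀ w : ℂ} (hw₀ : w₀ ∈ Ω) (hw : w ∈ Ω) :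
    ‖y w‖ ≤ ‖y w₀‖ * Real.exp (V * ‖w - w₀‖) := by
  have hγ (t : ℝ) (ht : t ∈ Set.Icc (0 : ℝ) 1) : w₀ + (t : ℂ) * (w - w₀) ∈ Ω := by
    have := hΩ.add_smul_sub_mem hw₀ hw ht
    rwa [Complex.real_smul] at this
  have hd (t : ℝ) (ht : t ∈ Set.Icc (0 : ℝ) 1) :
      HasDerivAt (fun s : ℝ => y (w₀ + (s : ℂ) * (w - w₀)))
        ((w - w₀) • y' (w₀ + (t : ℂ) * (w - w₀))) t := by
    have h1 : HasDerivAt (fun s : ℝ => w₀ + (s : ℂ) * (w - w₀)) (w - w₀) t := by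
      have := ((Complex.ofRealCLM.hasDerivAt (x := t)).mul_const (w - w₀)).const_add w₀
      simpa using this
    exact (hy _ (hγ t ht)).scomp t h1
  have h2 := norm_le_gronwallBound_of_norm_deriv_right_le (a := 0) (b := 1) (δ := ‖y w₀‖)
    (K := V * ‖w - w₀‖) (ε := 0)
    (fun t ht => (hd t ht).continuousAt.continuousWithinAt)
    (fun t ht => (hd t (Set.Ico_subset_Icc_self ht)).hasDerivWithinAt) (by simp)
    (fun t ht => by
      rw [norm_smul, add_zero]
      calc ‖w - w₀‖ * ‖y' (w₀ + (t : ℂ) * (w - w₀))‖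
          ≤ ‖w - w₀‖ * (V * ‖y (w₀ + (t : ℂ) * (w - w₀))‖) := by
            gcongr; exact hV _ (hγ t (Set.Ico_subset_Icc_self ht))
        _ = _ := by ring) 1 (by simp)
  rw [gronwallBound_ε0] at h2
  simpa using h2

/-- The half strip `Re w < -R`, `|Im w| < 7`, which contains `w` and `w + 2πi` for `w < -R`. -/
def strip (R : ℝ) : Set ℂ := {w | w.re < -R} ∩ {w | |w.im| < 7}

theorem convex_strip (R : ℝ) : Convex ℝ (strip R) := by
  refine (convex_halfSpace_re_lt _).inter ?_
  have : {w : ℂ | |w.im| < 7} = {w | -7 < w.im} ∩ {w | w.im < 7} := by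
    ext w; simp [abs_lt]
  rw [this]
  exact (convex_halfSpace_im_gt _).inter (convex_halfSpace_im_lt _)

theorem two_pi_lt_seven : 2 * Real.pi < 7 := by linarith [Real.pi_lt_d2]

/-- A function on the half strip whose derivative decays like `e^w` has a limit as `Re w → -∞`, and
the same one along a translate by `2πi`. -/
theorem tendsto_of_deriv_decay {E : Type*} [NormedAddCommGroup E] [NormedSpace ℂ E]
    [CompleteSpace E] {R : ℝ} {f f' : ℂ → E} (hf : ∀ w ∈ strip R, HasDerivAt f (f' w) w) {A : ℝ}
    (hA : ∀ w ∈ strip R, ‖f' w‖ ≤ A * Real.exp w.re) {m₀ : ℕ} (hm₀ : R < m₀) :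
    ∃ L : E, Filter.Tendsto (fun m : ℕ => f (-((m + m₀ : ℕ) : ℂ))) Filter.atTop (nhds L) ∧
      Filter.Tendsto (fun m : ℕ => f (-((m + m₀ : ℕ) : ℂ) + 2 * (Real.pi : ℂ) * Complex.I))
        Filter.atTop (nhds L) := by
  have hA0 : 0 ≤ A := by
    have h1 : (-(m₀ : ℂ)) ∈ strip R := ⟨by simpa using hm₀, by simp⟩
    have := (norm_nonneg _).trans (hA _ h1)
    exact nonneg_of_mul_nonneg_left this (Real.exp_pos _)
  have hmv (m : ℕ) {w₁ w₂ : ℂ} (h₁ : w₁.re ≤ -((m + m₀ : ℕ) : ℝ)) (h₁' : |w₁.im| < 7)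
      (h₂ : w₂.re ≤ -((m + m₀ : ℕ) : ℝ)) (h₂' : |w₂.im| < 7) :
      ‖f w₂ - f w₁‖ ≤ A * Real.exp (-((m + m₀ : ℕ) : ℝ)) * ‖w₂ - w₁‖ := by
    have hsub : ∀ w ∈ strip R ∩ {w | w.re ≤ -((m + m₀ : ℕ) : ℝ)}, w ∈ strip R := fun w hw => hw.1
    have hm : -((m + m₀ : ℕ) : ℝ) < -R := by
      push_cast
      have : (0 : ℝ) ≤ m := m.cast_nonneg
      linarith
    refine ((convex_strip R).inter (convex_halfSpace_re_le _)).norm_image_sub_le_of_norm_hasDerivWithin_le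
      (fun w hw => (hf w hw.1).hasDerivWithinAt) (fun w hw => (hA w hw.1).trans ?_)
      ⟨⟨h₁.trans_lt hm, h₁'⟩, h₁⟩ ⟨⟨h₂.trans_lt hm, h₂'⟩, h₂⟩
    gcongr
    exact hw.2
  have hexp (m : ℕ) : A * Real.exp (-((m + m₀ : ℕ) : ℝ)) =
      A * Real.exp (-(m₀ : ℝ)) * Real.exp (-1) ^ m := by
    rw [← Real.exp_nat_mul, mul_assoc, ← Real.exp_add]
    congr 2
    push_cast
    ring
  have hlt : Real.exp (-1) < 1 := by rw [Real.exp_lt_one_iff]; norm_num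
  have hcauchy : CauchySeq fun m : ℕ => f (-((m + m₀ : ℕ) : ℂ)) := by
    refine cauchySeq_of_le_geometric (Real.exp (-1)) (A * Real.exp (-(m₀ : ℝ))) hlt fun m => ?_
    rw [dist_eq_norm, norm_sub_rev, ← hexp]
    refine (hmv m (by simp) (by simp) ?_ (by simp)).trans (le_of_eq ?_)
    · simp only [Complex.neg_re, Complex.natCast_re]
      push_cast
      linarith
    have : -((m + 1 + m₀ : ℕ) : ℂ) - -((m + m₀ : ℕ) : ℂ) = -1 := by push_cast; ring
    rw [this, norm_neg, norm_one, mul_one]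
  obtain ⟨L, hL⟩ := cauchySeq_tendsto_of_complete hcauchy
  refine ⟨L, hL, ?_⟩
  have h1 : Filter.Tendsto (fun m : ℕ => f (-((m + m₀ : ℕ) : ℂ) + 2 * (Real.pi : ℂ) * Complex.I) -
      f (-((m + m₀ : ℕ) : ℂ))) Filter.atTop (nhds 0) := by
    refine squeeze_zero_norm (a := fun m => A * Real.exp (-(m₀ : ℝ)) * Real.exp (-1) ^ m *
      (2 * Real.pi)) (fun m => ?_) ?_
    · rw [← hexp]
      refine (hmv m (by simp) (by simp) (by simp) ?_).trans (le_of_eq ?_)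
      · simp [abs_of_pos Real.pi_pos, two_pi_lt_seven]
      · simp [abs_of_pos Real.pi_pos]
    · have := ((tendsto_pow_atTop_nhds_zero_of_lt_one (Real.exp_pos _).le hlt).const_mul
        (A * Real.exp (-(m₀ : ℝ)))).mul_const (2 * Real.pi)
      simpa using this
  simpa using h1.add hL

end

section

variable {n : ℕ} {G : Subgroup (GL (Fin n) ℂ)}

open NormedSpace (exp)
open Metric (ball)

/-! ### The singular point -/

/-- `h` is a `G`-valued multivalued flat frame near the singular point `z = 0`, with monodromy `M`,
for the connection form `v(z) dz/z` on the disc of radius `ρ`. It is written in the coordinate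
`w = log z` of the universal cover of the punctured disc, in which flatness reads
`h'(w) = -v(e^w) h(w)`. -/
structure LogFlat (G : Subgroup (GL (Fin n) ℂ)) (ρ : ℝ) (v h : ℂ → Mat n) (M : Mat n) : Prop where
  diff : DifferentiableOn ℂ v (ball 0 ρ)
  mem_lie : ∀ z ∈ ball (0 : ℂ) ρ, v z ∈ lieAlg G
  deriv : ∀ w, Complex.exp w ∈ ball (0 : ℂ) ρ → HasDerivAt h (-(v (Complex.exp w)) * h w) w
  mem : ∀ w, Complex.exp w ∈ ball (0 : ℂ) ρ → h w ∈ matSet G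
  period : ∀ w, Complex.exp w ∈ ball (0 : ℂ) ρ → h (w + 2 * (Real.pi : ℂ) * Complex.I) = h w * M

theorem hasDerivAt_exp_pow_smul (Y : Mat n) (j : ℕ) (w : ℂ) :
    HasDerivAt (fun w => exp ((Complex.exp w ^ j) • Y))
      (((j : ℂ) * Complex.exp w ^ j) • (Y * exp ((Complex.exp w ^ j) • Y))) w := by
  have h1 : HasDerivAt (fun w => Complex.exp w ^ j) ((j : ℂ) * Complex.exp w ^ j) w := by
    have := (Complex.hasDerivAt_exp w).pow j
    refine this.congr_deriv ?_
    rcases j with _ | j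
    · simp
    · rw [Nat.add_sub_cancel, pow_succ]; ring
  exact (hasDerivAt_exp_smul Y (Complex.exp w ^ j)).scomp w h1

theorem differentiable_exp_smul (Y : Mat n) : Differentiable ℂ fun t : ℂ => exp (t • Y) :=
  fun t => (hasDerivAt_exp_smul Y t).differentiableAt

/-- The coefficient of order `j` of the connection form can be removed by the gauge transformation
`exp(-z^j Y)` with a suitable `Y` in the Lie algebra. -/
theorem LogFlat.gauge (hG : IsAlgebraic G) {C : Mat n} (hC : C ∈ lieAlg G)
    (hprep : WeaklyPrepared G C) {ρ : ℝ} (hρ : 0 < ρ) {v h : ℂ → Mat n} {M : Mat n}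
    (hL : LogFlat G ρ v h M) {j : ℕ} (hj : j ≠ 0) {r : ℂ → Mat n}
    (hr : DifferentiableOn ℂ r (ball 0 ρ)) (hv : ∀ z ∈ ball (0 : ℂ) ρ, v z = C + z ^ j • r z) :
    ∃ v' h' r' : ℂ → Mat n, LogFlat G ρ v' h' M ∧ DifferentiableOn ℂ r' (ball 0 ρ) ∧
      ∀ z ∈ ball (0 : ℂ) ρ, v' z = C + z ^ (j + 1) • r' z := by
  have h0 : (0 : ℂ) ∈ ball (0 : ℂ) ρ := Metric.mem_ball_self hρ
  have hnhds : ball (0 : ℂ) ρ ∈ nhds (0 : ℂ) := Metric.isOpen_ball.mem_nhds h0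
  -- the leading coefficient is a limit of elements of the Lie algebra
  have hr0 : r 0 ∈ lieAlg G := by
    have h1 : Filter.Tendsto r (nhdsWithin 0 {0}ᶜ) (nhds (r 0)) :=
      ((hr.differentiableAt hnhds).continuousAt.tendsto).mono_left nhdsWithin_le_nhds
    refine isClosed_lieAlg.mem_of_tendsto h1 ?_
    filter_upwards [nhdsWithin_le_nhds hnhds, self_mem_nhdsWithin] with z hz hz0
    have h2 : r z = (z ^ j)⁻¹ • (v z - C) := by
      rw [hv z hz, add_sub_cancel_left, smul_smul, inv_mul_cancel₀ (pow_ne_zero j hz0), one_smul]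
    rw [h2]
    exact (lieSub G).smul_mem _ ((lieSub G).sub_mem (hL.mem_lie z hz) hC)
  obtain ⟨Y, hY, hYr⟩ := exists_gauge_coefficient hG hC hprep (j := j) (by exact_mod_cast hj) hr0
  rw [Int.cast_natCast] at hYr
  set E : ℂ → Mat n := fun t => exp (t • Y) * C * exp ((-t) • Y) with hE
  have hneg : Differentiable ℂ fun t : ℂ => exp ((-t) • Y) :=
    (differentiable_exp_smul Y).comp differentiable_neg
  have hEd : Differentiable ℂ E := ((differentiable_exp_smul Y).mul_const C).mul hneg
  have hE0 : E 0 = C := by simp [hE]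
  have hD : Differentiable ℂ (dslope E 0) := by
    rw [← differentiableOn_univ]
    exact (Complex.differentiableOn_dslope Filter.univ_mem).2 hEd.differentiableOn
  have hD0 : dslope E 0 0 = Y * C - C * Y := by
    rw [dslope_same]; exact (hasDerivAt_conj_exp Y C).deriv
  have hED (t : ℂ) : E t = C + t • dslope E 0 t := by
    have := sub_smul_dslope E 0 t
    rw [sub_zero, hE0] at this
    rw [this]; abel
  have hpow : Differentiable ℂ fun z : ℂ => z ^ j := differentiable_pow j
  set s : ℂ → Mat n := fun z => dslope E 0 (z ^ j) +
    exp ((z ^ j) • Y) * r z * exp ((-z ^ j) • Y) - (j : ℂ) • Y with hs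
  have hsd : DifferentiableOn ℂ s (ball 0 ρ) := by
    refine DifferentiableOn.sub_const (c := _) (DifferentiableOn.add ?_ ?_)
    · exact (hD.comp hpow).differentiableOn
    · exact ((((differentiable_exp_smul Y).comp hpow).differentiableOn).mul hr).mul
        (hneg.comp hpow).differentiableOn
  have hs0 : s 0 = 0 := by
    simp only [hs, zero_pow hj, hD0, ← hYr]
    simp only [neg_zero, zero_smul, NormedSpace.exp_zero, one_mul, mul_one]
    abel
  have hsv (z : ℂ) (hz : z ∈ ball (0 : ℂ) ρ) :
      exp ((z ^ j) • Y) * v z * exp ((-z ^ j) • Y) - ((j : ℂ) * z ^ j) • Y = C + z ^ j • s z := by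
    have h1 : exp ((z ^ j) • Y) * v z * exp ((-z ^ j) • Y) =
        E (z ^ j) + z ^ j • (exp ((z ^ j) • Y) * r z * exp ((-z ^ j) • Y)) := by
      rw [hv z hz, mul_add, add_mul, Matrix.mul_smul, Matrix.smul_mul]
    rw [h1, hED, hs]
    simp only [smul_sub, smul_add, smul_smul, mul_comm (j : ℂ)]
    abel
  have hexpmem (z : ℂ) : exp ((z ^ j) • Y) ∈ matSet G := exp_mem_matSet hG hY _
  refine ⟨fun z => exp ((z ^ j) • Y) * v z * exp ((-z ^ j) • Y) - ((j : ℂ) * z ^ j) • Y,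
    fun w => exp ((Complex.exp w ^ j) • Y) * h w, dslope s 0, ⟨?_, ?_, ?_, ?_, ?_⟩, ?_, ?_⟩
  · refine DifferentiableOn.sub ?_ ?_
    · exact ((((differentiable_exp_smul Y).comp hpow).differentiableOn).mul hL.diff).mul
        (hneg.comp hpow).differentiableOn
    · exact ((hpow.const_mul _).smul_const Y).differentiableOn
  · intro z hz
    exact (lieSub G).sub_mem (conj_mem_lieAlg (hexpmem z) (exp_mem_matSet hG hY _)
      (exp_smul_mul_exp_neg Y _) (hL.mem_lie z hz)) ((lieSub G).smul_mem _ hY)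
  · intro w hw
    refine ((hasDerivAt_exp_pow_smul Y j w).mul (hL.deriv w hw)).congr_deriv ?_
    generalize Complex.exp w = z
    have h1 := exp_neg_mul_exp_smul Y (z ^ j)
    simp only [neg_sub, sub_mul, Matrix.smul_mul, neg_mul, mul_neg]
    have h2 : exp ((z ^ j) • Y) * v z * exp ((-z ^ j) • Y) * (exp ((z ^ j) • Y) * h w) =
        exp ((z ^ j) • Y) * (v z * h w) := by
      rw [mul_assoc, ← mul_assoc (exp ((-z ^ j) • Y)), h1, one_mul, mul_assoc]
    rw [h2, mul_assoc]
    abel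
  · intro w hw
    exact mul_mem_matSet (hexpmem _) (hL.mem w hw)
  · intro w hw
    simp only [hL.period w hw]
    rw [Complex.exp_add, Complex.exp_two_pi_mul_I, mul_one, mul_assoc]
  · exact (Complex.differentiableOn_dslope hnhds).2 hsd
  · intro z hz
    have h1 := sub_smul_dslope s 0 z
    rw [sub_zero, hs0, sub_zero] at h1
    beta_reduce
    rw [hsv z hz, pow_succ, mul_smul, h1]

/-- After finitely many gauge transformations the connection form agrees with `C dz/z` to any
prescribed order. -/
theorem LogFlat.exists_order (hG : IsAlgebraic G) {C : Mat n} (hC : C ∈ lieAlg G)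
    (hprep : WeaklyPrepared G C) {ρ : ℝ} (hρ : 0 < ρ) {v h : ℂ → Mat n} {M : Mat n}
    (hL : LogFlat G ρ v h M) (hv : v 0 = C) (k : ℕ) :
    ∃ v' h' r' : ℂ → Mat n, LogFlat G ρ v' h' M ∧ DifferentiableOn ℂ r' (ball 0 ρ) ∧
      ∀ z ∈ ball (0 : ℂ) ρ, v' z = C + z ^ (k + 1) • r' z := by
  induction k with
  | zero =>
    have hnhds : ball (0 : ℂ) ρ ∈ nhds (0 : ℂ) := Metric.ball_mem_nhds 0 hρ
    refine ⟨v, h, dslope v 0, hL, (Complex.differentiableOn_dslope hnhds).2 hL.diff, fun z hz => ?_⟩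
    have h1 := sub_smul_dslope v 0 z
    rw [sub_zero, hv] at h1
    rw [zero_add, pow_one, h1]; abel
  | succ k ih =>
    obtain ⟨v', h', r', hL', hr', hv'⟩ := ih
    exact hL'.gauge hG hC hprep hρ k.succ_ne_zero hr' hv'

theorem hasDerivAt_inv_matrix {h : ℂ → Mat n} {h' : Mat n} {w : ℂ} (hh : HasDerivAt h h' w)
    (hu : IsUnit (h w).det) : HasDerivAt (fun w => (h w)⁻¹) (-((h w)⁻¹ * h' * (h w)⁻¹)) w := by
  obtain ⟨u, hu⟩ := (Matrix.isUnit_iff_isUnit_det _).2 hu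
  have h1 : HasFDerivAt (Ring.inverse : Mat n → Mat n) _ (h w) :=
    hu ▸ hasFDerivAt_ringInverse (𝕜 := ℂ) u
  have h2 := h1.comp_hasDerivAt w hh
  have e : (fun w => (h w)⁻¹) = Ring.inverse ∘ h := by
    funext w; exact Matrix.nonsing_inv_eq_ringInverse _
  rw [e]
  refine h2.congr_deriv ?_
  have e2 : (h w)⁻¹ = ((u⁻¹ : (Mat n)ˣ) : Mat n) := by rw [← hu]; simp
  rw [e2]
  simp

theorem continuousAt_val (p : Reg n) {A : Mat n} (hA : A.det ≠ 0) :
    ContinuousAt (fun B : Mat n => p.val B) A := by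
  induction p using MvPolynomial.induction_on with
  | C a => simp only [val_C]; exact continuousAt_const
  | add p q hp hq => simp only [val_add]; exact hp.add hq
  | mul_X p c hp =>
    simp only [val_mul, val_X]
    refine hp.mul ?_
    rcases c with _ | ij
    · exact (differentiable_det A).continuousAt.inv₀ hA
    · exact (differentiable_entry ij.1 ij.2 A).continuousAt

/-- The limit of `exp(wC) h(w)` conjugates the monodromy of a flat frame to `exp(-2πiC)`, provided
that the connection form agrees with `C dz/z` to sufficiently high order. -/
theorem LogFlat.exists_conj_of_order (hG : IsAlgebraic G) {C : Mat n} (hC : C ∈ lieAlg G) {ρ : ℝ}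
    (hρ : 0 < ρ) {v h r : ℂ → Mat n} {M : Mat n} (hL : LogFlat G ρ v h M) {k : ℕ}
    (hk : 2 * ‖C‖ + 2 ≤ k) (hr : DifferentiableOn ℂ r (ball 0 ρ))
    (hv : ∀ z ∈ ball (0 : ℂ) ρ, v z = C + z ^ k • r z) :
    ∃ K ∈ matSet G, exp ((2 * (Real.pi : ℂ) * Complex.I) • C) * K * M = K := by
  set c : ℝ := ‖C‖ with hc
  have hc0 : 0 ≤ c := norm_nonneg C
  have hk0 : k ≠ 0 := by rintro rfl; simp at hk; linarith
  have h0 : (0 : ℂ) ∈ ball (0 : ℂ) ρ := Metric.mem_ball_self hρ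
  have hnhds : ball (0 : ℂ) ρ ∈ nhds (0 : ℂ) := Metric.isOpen_ball.mem_nhds h0
  have hv0 : v 0 = C := by rw [hv 0 h0, zero_pow hk0, zero_smul, add_zero]
  set b : ℝ := ‖r 0‖ + 1 with hb
  obtain ⟨δ, hδ, hδb⟩ := Metric.eventually_nhds_iff_ball.1
    (((hr.differentiableAt hnhds).continuousAt.norm.eventually_lt_const
      (show ‖r 0‖ < b by rw [hb]; linarith)).and
    (((hL.diff.differentiableAt hnhds).continuousAt.norm.eventually_lt_const
      (show ‖v 0‖ < c + 1 by rw [hv0]; linarith)).and hnhds))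
  obtain ⟨R, hR0, hR⟩ : ∃ R : ℝ, 0 < R ∧ Real.exp (-R) < δ := by
    refine ⟨max 1 (-Real.log δ + 1), by positivity, ?_⟩
    rw [← Real.lt_log_iff_exp_lt hδ]
    linarith [le_max_right 1 (-Real.log δ + 1)]
  have hΩ {w : ℂ} (hw : w ∈ strip R) : Complex.exp w ∈ ball (0 : ℂ) δ := by
    rw [mem_ball_zero_iff, Complex.norm_exp]
    exact (Real.exp_lt_exp.2 hw.1).trans hR
  have hΩρ {w : ℂ} (hw : w ∈ strip R) : Complex.exp w ∈ ball (0 : ℂ) ρ := (hδb _ (hΩ hw)).2.2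
  have hΩv {w : ℂ} (hw : w ∈ strip R) : ‖v (Complex.exp w)‖ ≤ c + 1 := (hδb _ (hΩ hw)).2.1.le
  have hΩr {w : ℂ} (hw : w ∈ strip R) : ‖r (Complex.exp w)‖ ≤ b := (hδb _ (hΩ hw)).1.le
  have hdet {w : ℂ} (hw : w ∈ strip R) : IsUnit (h w).det :=
    isUnit_det_of_mem_matSet (hL.mem w (hΩρ hw))
  have hinv {w : ℂ} (hw : w ∈ strip R) :
      HasDerivAt (fun w => (h w)⁻¹) ((h w)⁻¹ * v (Complex.exp w)) w := by
    refine (hasDerivAt_inv_matrix (hL.deriv w (hΩρ hw)) (hdet hw)).congr_deriv ?_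
    rw [neg_mul, mul_neg, neg_mul, neg_neg, mul_assoc, mul_assoc, Matrix.mul_nonsing_inv _ (hdet hw),
      mul_one]
  set w₀ : ℂ := ((-R - 1 : ℝ) : ℂ) with hw₀
  have hw₀R : w₀ ∈ strip R := ⟨by simp [hw₀], by simp [hw₀]⟩
  -- a priori bounds: all factors grow at most exponentially in `-Re w`
  have hdist {w : ℂ} (hw : w ∈ strip R) : ‖w - w₀‖ ≤ -w.re + (R + 8) := by
    refine (Complex.norm_le_abs_re_add_abs_im _).trans ?_
    have h1 : |(w - w₀).re| ≤ -w.re + (R + 1) := by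
      rw [Complex.sub_re, hw₀, Complex.ofReal_re, abs_le]
      have := hw.1
      simp only [Set.mem_ofPred_eq] at this
      constructor <;> linarith
    have h2 : |(w - w₀).im| < 7 := by
      rw [Complex.sub_im, hw₀, Complex.ofReal_im, sub_zero]; exact hw.2
    linarith
  have hgrow {y y' : ℂ → Mat n} {V : ℝ} (hV0 : 0 ≤ V) (hy : ∀ w ∈ strip R, HasDerivAt y (y' w) w)
      (hV : ∀ w ∈ strip R, ‖y' w‖ ≤ V * ‖y w‖) : ∃ B : ℝ, 0 ≤ B ∧
        ∀ w ∈ strip R, ‖y w‖ ≤ B * Real.exp (-(V * w.re)) := by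
    refine ⟨‖y w₀‖ * Real.exp (V * (R + 8)), by positivity, fun w hw => ?_⟩
    refine (norm_le_exp_mul_of_hasDerivAt (convex_strip R) hy hV hw₀R hw).trans ?_
    rw [mul_assoc, ← Real.exp_add]
    gcongr
    calc V * ‖w - w₀‖ ≤ V * (-w.re + (R + 8)) := by gcongr; exact hdist hw
      _ = _ := by ring
  obtain ⟨B₁, hB₁, hhb⟩ := hgrow (y := h) (V := c + 1) (by positivity)
    (fun w hw => hL.deriv w (hΩρ hw)) (fun w hw => by
      refine (norm_mul_le _ _).trans ?_
      rw [norm_neg]; gcongr; exact hΩv hw)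
  obtain ⟨B₂, hB₂, hib⟩ := hgrow (y := fun w => (h w)⁻¹) (V := c + 1) (by positivity)
    (fun w hw => hinv hw) (fun w hw => by
      refine (norm_mul_le _ _).trans ?_
      rw [mul_comm]; gcongr; exact hΩv hw)
  obtain ⟨B₃, hB₃, heb⟩ := hgrow (y := fun w => exp (w • C)) (V := c) hc0
    (fun w _ => hasDerivAt_exp_smul C w) (fun w _ => norm_mul_le _ _)
  obtain ⟨B₄, hB₄, hnb⟩ := hgrow (y := fun w => exp (w • (-C))) (V := c) hc0
    (fun w _ => hasDerivAt_exp_smul (-C) w) (fun w _ => by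
      refine (norm_mul_le _ _).trans ?_
      rw [norm_neg])
  have hpow {w : ℂ} (hw : w ∈ strip R) :
      ‖Complex.exp w ^ k‖ * (Real.exp (-(c * w.re)) * Real.exp (-((c + 1) * w.re))) ≤
        Real.exp w.re := by
    rw [norm_pow, Complex.norm_exp, ← Real.exp_nat_mul, ← Real.exp_add, ← Real.exp_add]
    refine Real.exp_le_exp.2 ?_
    have h1 : w.re < 0 := by have := hw.1; simp only [Set.mem_ofPred_eq] at this; linarith
    nlinarith
  have hb0 : 0 ≤ b := by positivity
  obtain ⟨m₀, hm₀⟩ := exists_nat_gt R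
  -- `u = exp(wC) h` converges at `-∞`
  obtain ⟨K, hK1, hK2⟩ := tendsto_of_deriv_decay (R := R) (f := fun w => exp (w • C) * h w)
    (f' := fun w => -(Complex.exp w ^ k • (exp (w • C) * r (Complex.exp w) * h w)))
    (A := B₃ * b * B₁) (fun w hw => by
      refine ((hasDerivAt_exp_smul' C w).mul (hL.deriv w (hΩρ hw))).congr_deriv ?_
      rw [hv _ (hΩρ hw)]
      simp only [neg_mul, mul_neg, add_mul, mul_add, Matrix.smul_mul, Matrix.mul_smul, mul_assoc]
      abel) (fun w hw => by
      rw [norm_neg, norm_smul]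
      calc ‖Complex.exp w ^ k‖ * ‖exp (w • C) * r (Complex.exp w) * h w‖
          ≤ ‖Complex.exp w ^ k‖ * ((B₃ * Real.exp (-(c * w.re))) * b *
              (B₁ * Real.exp (-((c + 1) * w.re)))) := by
            gcongr
            refine (norm_mul_le _ _).trans ?_
            gcongr
            · refine (norm_mul_le _ _).trans ?_
              gcongr
              · exact heb w hw
              · exact hΩr hw
            · exact hhb w hw
        _ = B₃ * b * B₁ * (‖Complex.exp w ^ k‖ * (Real.exp (-(c * w.re)) *
              Real.exp (-((c + 1) * w.re)))) := by ring
        _ ≤ B₃ * b * B₁ * Real.exp w.re := by gcongr; exact hpow hw) hm₀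
  -- and so does its inverse
  obtain ⟨K', hK', -⟩ := tendsto_of_deriv_decay (R := R) (f := fun w => (h w)⁻¹ * exp (w • (-C)))
    (f' := fun w => Complex.exp w ^ k • ((h w)⁻¹ * r (Complex.exp w) * exp (w • (-C))))
    (A := B₂ * b * B₄) (fun w hw => by
      refine ((hinv hw).mul (hasDerivAt_exp_smul (-C) w)).congr_deriv ?_
      rw [hv _ (hΩρ hw)]
      simp only [neg_mul, mul_neg, add_mul, mul_add, Matrix.smul_mul, Matrix.mul_smul, mul_assoc]
      abel) (fun w hw => by
      rw [norm_smul]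
      calc ‖Complex.exp w ^ k‖ * ‖(h w)⁻¹ * r (Complex.exp w) * exp (w • (-C))‖
          ≤ ‖Complex.exp w ^ k‖ * ((B₂ * Real.exp (-((c + 1) * w.re))) * b *
              (B₄ * Real.exp (-(c * w.re)))) := by
            gcongr
            refine (norm_mul_le _ _).trans ?_
            gcongr
            · refine (norm_mul_le _ _).trans ?_
              gcongr
              · exact hib w hw
              · exact hΩr hw
            · exact hnb w hw
        _ = B₂ * b * B₄ * (‖Complex.exp w ^ k‖ * (Real.exp (-(c * w.re)) *
              Real.exp (-((c + 1) * w.re)))) := by ring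
        _ ≤ B₂ * b * B₄ * Real.exp w.re := by gcongr; exact hpow hw) hm₀
  have hmem (m : ℕ) : (-((m + m₀ : ℕ) : ℂ)) ∈ strip R := by
    refine ⟨?_, by simp⟩
    have : (0 : ℝ) ≤ m := m.cast_nonneg
    simp only [Set.mem_ofPred_eq, Complex.neg_re, Complex.natCast_re]
    push_cast
    linarith
  have hKK' : K * K' = 1 := by
    refine tendsto_nhds_unique (hK1.mul hK') (tendsto_const_nhds.congr fun m => ?_)
    have h1 := Matrix.mul_nonsing_inv _ (hdet (hmem m))
    have h2 := exp_smul_mul_exp_neg C (-((m + m₀ : ℕ) : ℂ))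
    rw [smul_neg, ← neg_smul, mul_assoc, ← mul_assoc (h _), h1, one_mul, h2]
  have hKdet : IsUnit K.det := Matrix.isUnit_det_of_right_inverse hKK'
  refine ⟨K, mem_matSet_of_vanishing hG hKdet fun p hp => ?_, ?_⟩
  · -- regular functions are continuous at the invertible matrix `K`
    have hcont := continuousAt_val p hKdet.ne_zero
    refine tendsto_nhds_unique (hcont.tendsto.comp hK1) (tendsto_const_nhds.congr fun m => ?_)
    exact (hp _ (mul_mem_matSet (exp_mem_matSet hG hC _) (hL.mem _ (hΩρ (hmem m))))).symm
  · have h1 := (hK1.const_mul (exp ((2 * (Real.pi : ℂ) * Complex.I) • C))).mul_const M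
    refine tendsto_nhds_unique h1 (hK2.congr fun m => ?_)
    rw [hL.period _ (hΩρ (hmem m)), add_comm (-((m + m₀ : ℕ) : ℂ)), exp_add_smul]
    simp only [mul_assoc]

end

section

open Metric (ball)

variable {n : ℕ} {G : Subgroup (GL (Fin n) ℂ)} {D : Set ℂ} {P : PrincipalBundle.{u, v} G D}

/-! ### Flat sections -/

theorem mat_mem_matSet (h : ℂ → G) (z : ℂ) : mat h z ∈ matSet G := coe_mem_matSet (h z)

theorem isUnit_det_mat (h : ℂ → G) (z : ℂ) : IsUnit (mat h z).det :=
  isUnit_det_of_mem_matSet (mat_mem_matSet h z)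

theorem eq_of_coe_eq {g k : G} (h : ((g : GL (Fin n) ℂ) : Mat n) = ((k : GL (Fin n) ℂ) : Mat n)) :
    g = k := Subtype.ext (Units.ext h)

theorem HolOn.mul {A B : ℂ → Mat n} {U : Set ℂ} (hA : HolOn A U) (hB : HolOn B U) :
    HolOn (fun z => A z * B z) U :=
  differentiableOn_matrix.1 ((differentiableOn_matrix.2 hA).mul (differentiableOn_matrix.2 hB))

theorem HolOn.mono {A : ℂ → Mat n} {U V : Set ℂ} (hA : HolOn A U) (h : V ⊆ U) : HolOn A V :=
  fun k l => (hA k l).mono h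

theorem PrincipalBundle.act_left_cancel {e : P.Total} {g k : G} (h : P.act e g = P.act e k) :
    g = k :=
  (P.simply_transitive e (P.act e k) (P.proj_act e k).symm).unique h rfl

theorem LogConnection.IsFlatSection.act {N : LogConnection P} {V : Set ℂ} {τ : ℂ → P.Total}
    (hV : IsOpen V) (hτ : N.IsFlatSection V τ) (c : G) :
    N.IsFlatSection V fun z => P.act (τ z) c := by
  refine ⟨fun x hx => by rw [P.proj_act, hτ.1 x hx], fun i => ?_⟩
  obtain ⟨h, hh, hflat⟩ := hτ.2 i
  have hc : HolOn (fun _ => ((c : GL (Fin n) ℂ) : Mat n)) (V ∩ P.dom i) :=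
    fun k l => differentiableOn_const _
  refine ⟨fun z => h z * c, hh.mul hc, fun x hx => ⟨?_, ?_⟩⟩
  · beta_reduce
    rw [(hflat x hx).1, P.act_mul]
  · have h1 := (hh.hasDerivAt (hV.inter (P.isOpen_dom i)) hx).mul_const ((c : GL (Fin n) ℂ) : Mat n)
    have h2 : matDeriv (mat fun z => h z * c) x =
        matDeriv (mat h) x * ((c : GL (Fin n) ℂ) : Mat n) := matDeriv_eq h1
    have h3 : mat (fun z => h z * c) x = mat h x * ((c : GL (Fin n) ℂ) : Mat n) := rfl
    rw [h2, h3, ← Matrix.smul_mul, ← mul_assoc, ← add_mul, (hflat x hx).2, zero_mul]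

/-- Two flat sections differ by a locally constant element of `G`. -/
theorem LogConnection.IsFlatSection.eventually_eq_act {N : LogConnection P} {V V' : Set ℂ}
    {τ τ' : ℂ → P.Total} (hV : IsOpen V) (hVD : V ⊆ D \ {0}) (hτ : N.IsFlatSection V τ)
    (hV' : IsOpen V') (hτ' : N.IsFlatSection V' τ') {x : ℂ} (hx : x ∈ V) (hx' : x ∈ V') :
    ∃ c : G, ∀ᶠ z in nhds x, τ' z = P.act (τ z) c := by
  obtain ⟨i, hi⟩ := P.cover x (hVD hx).1
  obtain ⟨h, hh, hflat⟩ := hτ.2 i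
  obtain ⟨h', hh', hflat'⟩ := hτ'.2 i
  have hopen : IsOpen (V ∩ V' ∩ P.dom i) := (hV.inter hV').inter (P.isOpen_dom i)
  obtain ⟨ε, hε, hsub⟩ := Metric.isOpen_iff.1 hopen x ⟨⟨hx, hx'⟩, hi⟩
  have hd : ∀ z ∈ ball x ε, HasDerivAt (fun z => (mat h z)⁻¹ * mat h' z) 0 z := by
    intro z hz
    obtain ⟨⟨hzV, hzV'⟩, hzi⟩ := hsub hz
    have hz0 : z ≠ 0 := (hVD hzV).2
    have h1 := hh.hasDerivAt (hV.inter (P.isOpen_dom i)) ⟨hzV, hzi⟩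
    have h2 := hh'.hasDerivAt (hV'.inter (P.isOpen_dom i)) ⟨hzV', hzi⟩
    refine ((hasDerivAt_inv_matrix h1 (isUnit_det_mat h z)).mul h2).congr_deriv ?_
    have e1 : matDeriv (mat h) z = -(z⁻¹ • (N.form i z * mat h z)) := by
      rw [← eq_neg_of_add_eq_zero_left (hflat z ⟨hzV, hzi⟩).2 |> neg_eq_iff_eq_neg.2, smul_neg,
        smul_smul, inv_mul_cancel₀ hz0, one_smul, neg_neg]
    have e2 : matDeriv (mat h') z = -(z⁻¹ • (N.form i z * mat h' z)) := by
      rw [← eq_neg_of_add_eq_zero_left (hflat' z ⟨hzV', hzi⟩).2 |> neg_eq_iff_eq_neg.2, smul_neg,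
        smul_smul, inv_mul_cancel₀ hz0, one_smul, neg_neg]
    rw [e1, e2]
    simp only [mul_neg, neg_mul, neg_neg, Matrix.mul_smul, Matrix.smul_mul, mul_assoc]
    rw [← mul_assoc (mat h z) (mat h z)⁻¹, Matrix.mul_nonsing_inv _ (isUnit_det_mat h z), one_mul,
      add_neg_cancel]
  refine ⟨(h x)⁻¹ * h' x, ?_⟩
  filter_upwards [Metric.ball_mem_nhds x hε] with z hz
  have h1 : (mat h z)⁻¹ * mat h' z = (mat h x)⁻¹ * mat h' x := by
    have := (convex_ball x ε).norm_image_sub_le_of_norm_hasDerivWithin_le (C := 0)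
      (fun y hy => (hd y hy).hasDerivWithinAt) (fun y _ => by rw [norm_zero])
      (Metric.mem_ball_self hε) hz
    rw [zero_mul] at this
    exact sub_eq_zero.1 (norm_le_zero_iff.1 this)
  have h2 : (h z)⁻¹ * h' z = (h x)⁻¹ * h' x := by
    refine eq_of_coe_eq ?_
    simpa [mat] using h1
  obtain ⟨⟨hzV, hzV'⟩, hzi⟩ := hsub hz
  rw [← h2, (hflat z ⟨hzV, hzi⟩).1, (hflat' z ⟨hzV', hzi⟩).1, ← P.act_mul, mul_inv_cancel_left]

/-- Flat sections exist locally, away from the singular point. -/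
theorem LogConnection.exists_isFlatSection (N : LogConnection P) (hG : IsAlgebraic G) {x : ℂ}
    (hxD : x ∈ D) (hx0 : x ≠ 0) :
    ∃ V : Set ℂ, IsOpen V ∧ V ⊆ D \ {0} ∧ x ∈ V ∧ ∃ τ : ℂ → P.Total, N.IsFlatSection V τ := by
  obtain ⟨i, hi⟩ := P.cover x hxD
  obtain ⟨r, hr, hsub⟩ := Metric.isOpen_iff.1
    ((P.isOpen_dom i).sdiff (isClosed_singleton (x := (0 : ℂ)))) x ⟨hi, hx0⟩
  obtain ⟨ε, hε, hεr, h, hmem, hh⟩ := exists_fundamental_solution_mem hG hr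
    (B := fun z => (-z⁻¹) • N.form i z)
    (DifferentiableOn.smul (fun z hz => (differentiableAt_inv (hsub hz).2).neg.differentiableWithinAt)
      ((differentiableOn_matrix.2 (N.form_hol i)).mono fun z hz => (hsub hz).1))
    (fun z hz => (lieSub G).smul_mem _ (N.form_mem i z (hsub hz).1))
  have hsub' : ball x ε ⊆ P.dom i \ {0} := (Metric.ball_subset_ball hεr).trans hsub
  classical
  -- the solution as a `G`-valued function, with irrelevant values off the disc
  have hex (z : ℂ) : ∃ g : G, z ∈ ball x ε → ((g : GL (Fin n) ℂ) : Mat n) = h z := by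
    by_cases hz : z ∈ ball x ε
    · obtain ⟨g, hg, e⟩ := hmem z hz
      exact ⟨⟨g, hg⟩, fun _ => e⟩
    · exact ⟨1, fun hz' => absurd hz' hz⟩
  choose k hk using hex
  have hkd : ∀ z ∈ ball x ε, HasDerivAt (mat k) ((-z⁻¹) • (N.form i z * mat k z)) z := by
    intro z hz
    have h1 := hh z hz
    rw [← hk z hz, Matrix.smul_mul] at h1
    refine h1.congr_of_eventuallyEq ?_
    filter_upwards [Metric.isOpen_ball.mem_nhds hz] with y hy using hk y hy
  have hkhol : HolOn (mat k) (ball x ε) := differentiableOn_matrix.1 fun z hz =>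
    (hkd z hz).differentiableAt.differentiableWithinAt
  have hkflat : ∀ z ∈ ball x ε, z • matDeriv (mat k) z = -(N.form i z * mat k z) := by
    intro z hz
    rw [matDeriv_eq (hkd z hz), smul_smul, mul_neg, mul_inv_cancel₀ (hsub' hz).2, neg_one_smul]
  refine ⟨ball x ε, Metric.isOpen_ball, fun z hz => ⟨P.dom_subset i (hsub' hz).1, (hsub' hz).2⟩,
    Metric.mem_ball_self hε, fun z => P.act (P.frame i z) (k z),
    fun z hz => by rw [P.proj_act, P.proj_frame i z (hsub' hz).1], fun j => ?_⟩
  obtain ⟨g, hg, hgf⟩ := P.transition j i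
  have hinter : ball x ε ∩ P.dom j ⊆ P.dom j ∩ P.dom i := fun z hz => ⟨hz.2, (hsub' hz.1).1⟩
  have hghol : HolOn (mat g) (ball x ε ∩ P.dom j) := hg.mono hinter
  have hkhol' : HolOn (mat k) (ball x ε ∩ P.dom j) := hkhol.mono Set.inter_subset_left
  have hopen : IsOpen (ball x ε ∩ P.dom j) := Metric.isOpen_ball.inter (P.isOpen_dom j)
  refine ⟨fun z => g z * k z, hghol.mul hkhol', fun z hz => ⟨?_, ?_⟩⟩
  · beta_reduce
    rw [hgf z (hinter hz), ← P.act_mul]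
  · have h1 := (hghol.hasDerivAt hopen hz).mul (hkhol'.hasDerivAt hopen hz)
    have h2 : matDeriv (mat fun z => g z * k z) z = _ := matDeriv_eq h1
    have h3 : mat (fun z => g z * k z) z = mat g z * mat k z := rfl
    have h4 := N.gauge j i g hg hgf z (hinter hz)
    rw [h2, h3, smul_add, ← Matrix.smul_mul, ← Matrix.mul_smul, hkflat z hz.1, mul_neg, ← mul_assoc,
      ← mul_assoc, h4, add_mul]
    abel

/-! ### The covering space of flat sections -/

/-- The total space of the bundle with the topology whose basic open sets are the images of flat
sections. Away from the singular fibre it is a covering space of the base. -/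
def FlatTotal (_N : LogConnection P) : Type u := P.Total

instance (N : LogConnection P) : TopologicalSpace (FlatTotal N) where
  IsOpen U := ∀ (V : Set ℂ) (τ : ℂ → P.Total), IsOpen V → V ⊆ D \ {0} → N.IsFlatSection V τ →
    IsOpen {z | z ∈ V ∧ τ z ∈ U}
  isOpen_univ V τ hV _ _ := by
    convert hV using 1
    ext z
    exact and_iff_left (Set.mem_univ _)
  isOpen_inter U U' hU hU' V τ hV hVD hτ := by
    convert (hU V τ hV hVD hτ).inter (hU' V τ hV hVD hτ) using 1
    ext z
    constructor
    · rintro ⟨h1, h2, h3⟩; exact ⟨⟨h1, h2⟩, h1, h3⟩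
    · rintro ⟨⟨h1, h2⟩, _, h3⟩; exact ⟨h1, h2, h3⟩
  isOpen_sUnion S hS V τ hV hVD hτ := by
    have : {z | z ∈ V ∧ τ z ∈ ⋃₀ S} = ⋃ U ∈ S, {z | z ∈ V ∧ τ z ∈ U} := by
      ext z
      simp only [Set.mem_ofPred_eq, Set.mem_iUnion]
      constructor
      · rintro ⟨h1, U, hU, h2⟩; exact ⟨U, hU, h1, h2⟩
      · rintro ⟨U, hU, h1, h2⟩; exact ⟨h1, U, hU, h2⟩
    rw [this]
    exact isOpen_biUnion fun U hU => hS U hU V τ hV hVD hτ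

variable {N : LogConnection P}

theorem isOpen_flatTotal {U : Set (FlatTotal N)} : IsOpen U ↔ ∀ (V : Set ℂ) (τ : ℂ → P.Total),
    IsOpen V → V ⊆ D \ {0} → N.IsFlatSection V τ → IsOpen {z | z ∈ V ∧ τ z ∈ U} := Iff.rfl

/-- The identity map from the total space to the covering space of flat sections. -/
def toFlat (N : LogConnection P) : P.Total → FlatTotal N := fun e => e

/-- The bundle projection on the covering space of flat sections. -/
def flatProj (N : LogConnection P) : FlatTotal N → ℂ := P.proj

theorem continuous_flatProj : Continuous (flatProj N) := by
  refine continuous_def.2 fun W hW => isOpen_flatTotal.2 fun V τ hV _ hτ => ?_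
  convert hV.inter hW using 1
  ext z
  refine and_congr_right fun hz => ?_
  change P.proj (τ z) ∈ W ↔ z ∈ W
  rw [hτ.1 z hz]

theorem continuous_act (c : G) : Continuous fun e : FlatTotal N => toFlat N (P.act e c) :=
  continuous_def.2 fun _ hU => isOpen_flatTotal.2 fun V τ hV hVD hτ =>
    isOpen_flatTotal.1 hU V (fun z => P.act (τ z) c) hV hVD (hτ.act hV c)

theorem LogConnection.IsFlatSection.continuousOn {V : Set ℂ} {τ : ℂ → P.Total} (hV : IsOpen V)
    (hVD : V ⊆ D \ {0}) (hτ : N.IsFlatSection V τ) :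
    ContinuousOn (fun z => toFlat N (τ z)) V :=
  (continuousOn_open_iff hV).2 fun _ hU => isOpen_flatTotal.1 hU V τ hV hVD hτ

theorem LogConnection.IsFlatSection.isOpen_image {V W : Set ℂ} {τ : ℂ → P.Total} (hV : IsOpen V)
    (hVD : V ⊆ D \ {0}) (hτ : N.IsFlatSection V τ) (hW : IsOpen W) (hWV : W ⊆ V) :
    IsOpen ((fun z => toFlat N (τ z)) '' W) := by
  refine isOpen_flatTotal.2 fun V' τ' hV' hVD' hτ' => ?_
  have e : {z | z ∈ V' ∧ τ' z ∈ ((fun z => toFlat N (τ z)) '' W)} =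
      {z | z ∈ V' ∧ z ∈ W ∧ τ' z = τ z} := by
    ext z
    refine and_congr_right fun hz => ?_
    constructor
    · rintro ⟨y, hy, h1⟩
      have h2 : P.proj (τ y) = P.proj (τ' z) := congrArg P.proj h1
      rw [hτ.1 y (hWV hy), hτ'.1 z hz] at h2
      subst h2
      exact ⟨hy, h1.symm⟩
    · rintro ⟨h1, h2⟩
      exact ⟨z, h1, h2.symm⟩
  rw [e, isOpen_iff_mem_nhds]
  rintro z ⟨hz', hz, heq⟩
  obtain ⟨c, hc⟩ := hτ.eventually_eq_act hV hVD hV' hτ' (hWV hz) hz'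
  have hc1 : c = 1 := by
    have h1 := hc.self_of_nhds
    rw [heq] at h1
    exact P.act_left_cancel (h1.symm.trans (P.act_one (τ z)).symm)
  filter_upwards [hc, hV'.mem_nhds hz', hW.mem_nhds hz] with y hy h1 h2
  exact ⟨h1, h2, by rw [hy, hc1, P.act_one]⟩

theorem isCoveringMapOn_flatProj (hG : IsAlgebraic G) :
    IsCoveringMapOn (flatProj N) (D \ {0}) := by
  rintro x ⟨hxD, hx0⟩
  obtain ⟨V, hV, hVD, hxV, τ, hτ⟩ := N.exists_isFlatSection hG hxD hx0
  -- the sheets are indexed by the group with the discrete topology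
  let _ : TopologicalSpace G := ⊥
  have hdisc : DiscreteTopology G := ⟨rfl⟩
  refine IsEvenlyCovered.to_isEvenlyCovered_preimage (I := G)
    ⟨hdisc, V, hxV, hV, hV.preimage continuous_flatProj, ?_⟩
  have hex (e : flatProj N ⁻¹' V) : ∃! g : G, P.act (τ (P.proj e.1)) g = e.1 :=
    P.simply_transitive _ _ (hτ.1 _ e.2)
  choose γ hγ hγu using hex
  refine ⟨{ toFun := fun e => (⟨P.proj e.1, e.2⟩, γ e)
            invFun := fun zg => ⟨P.act (τ zg.1.1) zg.2, ?_⟩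
            left_inv := ?_
            right_inv := ?_
            continuous_toFun := ?_
            continuous_invFun := ?_ }, fun e => rfl⟩
  · change P.proj _ ∈ V
    rw [P.proj_act, hτ.1 _ zg.1.2]
    exact zg.1.2
  · intro e
    exact Subtype.ext (hγ e)
  · rintro ⟨⟨z, hz⟩, g⟩
    have h1 : P.proj (P.act (τ z) g) = z := by rw [P.proj_act, hτ.1 z hz]
    refine Prod.ext (Subtype.ext h1) (hγu _ g ?_).symm
    change P.act (τ (P.proj (P.act (τ z) g))) g = P.act (τ z) g
    rw [h1]
  · refine Continuous.prodMk ?_ ?_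
    · exact (continuous_flatProj.comp continuous_subtype_val).subtype_mk _
    · refine continuous_discrete_rng.2 fun g => ?_
      have h1 := ((hτ.act hV g).isOpen_image hV hVD hV subset_rfl).preimage
        (continuous_subtype_val (p := fun e => e ∈ flatProj N ⁻¹' V))
      convert h1 using 1
      ext e
      constructor
      · rintro (rfl : γ e = g)
        exact ⟨P.proj e.1, e.2, hγ e⟩
      · rintro ⟨z, hz, h2⟩
        refine (hγu e g ?_).symm
        have h3 : P.proj (P.act (τ z) g) = P.proj e.1 := congrArg P.proj h2
        rw [P.proj_act, hτ.1 z hz] at h3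
        change P.act (τ (P.proj e.1)) g = e.1
        rw [← h3]
        exact h2
  · refine continuous_prod_of_discrete_right.2 fun g => ?_
    refine Continuous.subtype_mk ?_ _
    exact continuousOn_iff_continuous_domRestrict.1 ((hτ.act hV g).continuousOn hV hVD)

/-- Lifts to the covering space of flat sections are unique. -/
theorem lift_unique (hG : IsAlgebraic G) {A : Type*} [TopologicalSpace A] [PreconnectedSpace A]
    {f₁ f₂ : A → FlatTotal N} (h₁ : Continuous f₁) (h₂ : Continuous f₂)
    (he : ∀ a, flatProj N (f₁ a) = flatProj N (f₂ a)) (hD : ∀ a, flatProj N (f₁ a) ∈ D \ {0})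
    {a : A} (ha : f₁ a = f₂ a) : f₁ = f₂ := by
  have cov := (isCoveringMapOn_flatProj (N := N) hG).isCoveringMap_restrictPreimage
  have hD' (a : A) : f₂ a ∈ flatProj N ⁻¹' (D \ {0}) := by
    rw [Set.mem_preimage, ← he]; exact hD a
  have h := cov.eq_of_comp_eq (g₁ := fun a => ⟨f₁ a, hD a⟩) (g₂ := fun a => ⟨f₂ a, hD' a⟩)
    (h₁.subtype_mk _) (h₂.subtype_mk _) (funext fun a => Subtype.ext (he a)) a (Subtype.ext ha)
  exact funext fun a => congrArg Subtype.val (congrFun h a)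

end

section

open NormedSpace (exp)
open Metric (ball)

variable {n : ℕ} {G : Subgroup (GL (Fin n) ℂ)}

/-! ### The local monodromy -/

/-- Near a point outside the singular fibre, the covering space of flat sections is the graph of a
flat section. -/
theorem exists_isFlatSection_through {D : Set ℂ} {P : PrincipalBundle.{u, v} G D}
    {N : LogConnection P} (hG : IsAlgebraic G) (e : FlatTotal N) (he : flatProj N e ∈ D \ {0}) :
    ∃ V : Set ℂ, IsOpen V ∧ V ⊆ D \ {0} ∧ flatProj N e ∈ V ∧ ∃ τ : ℂ → P.Total,
      N.IsFlatSection V τ ∧ ∀ᶠ e' in nhds e, e' = toFlat N (τ (flatProj N e')) := by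
  obtain ⟨V, hV, hVD, hx, τ, hτ⟩ := N.exists_isFlatSection hG he.1 he.2
  obtain ⟨g, hg, -⟩ := P.simply_transitive (τ (flatProj N e)) e (hτ.1 _ hx)
  refine ⟨V, hV, hVD, hx, fun z => P.act (τ z) g, hτ.act hV g, ?_⟩
  have hopen := (hτ.act hV g).isOpen_image hV hVD hV subset_rfl
  filter_upwards [hopen.mem_nhds ⟨_, hx, hg⟩] with e' ⟨z, hz, h⟩
  have h1 : flatProj N e' = z := by
    rw [← h]
    exact (hτ.act hV g).1 z hz
  rw [h1]
  exact h.symm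

variable {a : ℝ} {P : PrincipalBundle.{u, v} G (ball (0 : ℂ) a)} {N : LogConnection P}

theorem exp_mem_ball_iff {w : ℂ} {r : ℝ} : Complex.exp w ∈ ball (0 : ℂ) r ↔ Real.exp w.re < r := by
  rw [mem_ball_zero_iff, Complex.norm_exp]

theorem exp_add_two_pi_I_mem_ball {w : ℂ} {r : ℝ} (hw : Complex.exp w ∈ ball (0 : ℂ) r) :
    Complex.exp (w + 2 * (Real.pi : ℂ) * Complex.I) ∈ ball (0 : ℂ) r := by
  rwa [Complex.exp_periodic w]

/-- `F` is a multivalued flat section over the punctured disc with monodromy `M`, in the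
coordinate `w = log z` of the universal cover. -/
structure MultivaluedFlat (N : LogConnection P) (F : ℂ → FlatTotal N) (M : G) : Prop where
  cont : ∀ w, Complex.exp w ∈ ball (0 : ℂ) a → ContinuousAt F w
  proj : ∀ w, Complex.exp w ∈ ball (0 : ℂ) a → flatProj N (F w) = Complex.exp w
  period : ∀ w, Complex.exp w ∈ ball (0 : ℂ) a →
    F (w + 2 * (Real.pi : ℂ) * Complex.I) = P.act (F w) M

/-- A point over the punctured disc extends to a multivalued flat section, because the universal
cover of the punctured disc, a half plane, is simply connected. -/
theorem exists_multivaluedFlat (hG : IsAlgebraic G) (ha : 0 < a) {w₀ : ℂ}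
    (hw₀ : Complex.exp w₀ ∈ ball (0 : ℂ) a) {e : P.Total} (he : P.proj e = Complex.exp w₀) :
    ∃ (F : ℂ → FlatTotal N) (M : G), MultivaluedFlat N F M ∧ F w₀ = e := by
  set S : Set ℂ := {w | w.re < Real.log a} with hS
  have hmem (w : ℂ) : w ∈ S ↔ Complex.exp w ∈ ball (0 : ℂ) a := by
    rw [exp_mem_ball_iff, ← Real.lt_log_iff_exp_lt ha]; rfl
  have hSo : IsOpen S := isOpen_lt Complex.continuous_re continuous_const
  have hconv : Convex ℝ S := convex_halfSpace_re_lt _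
  have hS₀ : w₀ ∈ S := (hmem w₀).2 hw₀
  have : ContractibleSpace S := hconv.contractibleSpace ⟨w₀, hS₀⟩
  have : LocallyPathConnectedSpace S := hSo.locallyPathConnectedSpace
  have cov := (isCoveringMapOn_flatProj (N := N) hG).isCoveringMap_restrictPreimage
  let f : C(S, (ball (0 : ℂ) a \ {0} : Set ℂ)) :=
    ⟨fun w => ⟨Complex.exp w, (hmem w).1 w.2, Complex.exp_ne_zero _⟩,
      (Complex.continuous_exp.comp continuous_subtype_val).subtype_mk _⟩
  have heD : toFlat N e ∈ flatProj N ⁻¹' (ball (0 : ℂ) a \ {0}) := by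
    change P.proj e ∈ (ball (0 : ℂ) a \ {0} : Set ℂ)
    rw [he]
    exact ⟨hw₀, Complex.exp_ne_zero _⟩
  obtain ⟨Φ, ⟨hΦ₀, hΦ⟩, -⟩ := cov.existsUnique_continuousMap_lifts f ⟨w₀, hS₀⟩ ⟨toFlat N e, heD⟩
    (Subtype.ext he)
  have hΦp (w : S) : flatProj N (Φ w).1 = Complex.exp w :=
    congrArg Subtype.val (congrFun hΦ w)
  classical
  let F : ℂ → FlatTotal N := fun w => if h : w ∈ S then (Φ ⟨w, h⟩).1 else toFlat N e
  have hF (w : S) : F w = (Φ w).1 := dif_pos w.2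
  have hFc : ContinuousOn F S := by
    rw [continuousOn_iff_continuous_domRestrict]
    exact (continuous_subtype_val.comp Φ.continuous).congr fun w => (hF w).symm
  have hFp : ∀ w ∈ S, flatProj N (F w) = Complex.exp w := fun w hw => by
    rw [hF ⟨w, hw⟩]; exact hΦp ⟨w, hw⟩
  have hshift : ∀ w ∈ S, w + 2 * (Real.pi : ℂ) * Complex.I ∈ S := fun w hw =>
    (hmem _).2 (exp_add_two_pi_I_mem_ball ((hmem w).1 hw))
  have hFs : ∀ w ∈ S, flatProj N (F (w + 2 * (Real.pi : ℂ) * Complex.I)) = Complex.exp w :=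
    fun w hw => by rw [hFp _ (hshift w hw), Complex.exp_periodic w]
  obtain ⟨M, hM, -⟩ := P.simply_transitive (F w₀) (F (w₀ + 2 * (Real.pi : ℂ) * Complex.I))
    ((hFp w₀ hS₀).trans (hFs w₀ hS₀).symm)
  have hact (w : S) : flatProj N (toFlat N (P.act (F w) M)) = Complex.exp w :=
    (P.proj_act _ _).trans (hFp w w.2)
  have : PreconnectedSpace S := isPreconnected_iff_preconnectedSpace.1 hconv.isPreconnected
  have hper := lift_unique (N := N) hG
    (f₁ := fun w : S => F (w + 2 * (Real.pi : ℂ) * Complex.I))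
    (f₂ := fun w : S => toFlat N (P.act (F w) M)) (a := ⟨w₀, hS₀⟩)
    (hFc.comp_continuous (continuous_subtype_val.add continuous_const) fun w => hshift w w.2)
    ((continuous_act M).comp (continuousOn_iff_continuous_domRestrict.1 hFc))
    (fun w => (hFs w w.2).trans (hact w).symm)
    (fun w => by rw [hFs w w.2]; exact ⟨(hmem w).1 w.2, Complex.exp_ne_zero _⟩) hM.symm
  refine ⟨F, M, ⟨fun w hw => hFc.continuousAt (hSo.mem_nhds ((hmem w).2 hw)),
    fun w hw => hFp w ((hmem w).2 hw), fun w hw => congrFun hper ⟨w, (hmem w).2 hw⟩⟩, ?_⟩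
  rw [hF ⟨w₀, hS₀⟩, hΦ₀]
  rfl

theorem MultivaluedFlat.eventually_eq (hG : IsAlgebraic G) {F : ℂ → FlatTotal N} {M : G}
    (hF : MultivaluedFlat N F M) {w : ℂ} (hw : Complex.exp w ∈ ball (0 : ℂ) a) :
    ∃ V : Set ℂ, IsOpen V ∧ V ⊆ ball (0 : ℂ) a \ {0} ∧ Complex.exp w ∈ V ∧ ∃ τ : ℂ → P.Total,
      N.IsFlatSection V τ ∧ ∀ᶠ w' in nhds w, F w' = τ (Complex.exp w') := by
  obtain ⟨V, hV, hVD, hx, τ, hτ, hτe⟩ := exists_isFlatSection_through hG (F w)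
    (by rw [hF.proj w hw]; exact ⟨hw, Complex.exp_ne_zero _⟩)
  rw [hF.proj w hw] at hx
  refine ⟨V, hV, hVD, hx, τ, hτ, ?_⟩
  filter_upwards [(hF.cont w hw).eventually hτe,
    Complex.continuous_exp.continuousAt.eventually (Metric.isOpen_ball.mem_nhds hw)] with w' h1 h2
  rw [hF.proj w' h2] at h1
  exact h1

theorem circleLoop_eq_exp {r : ℝ} (hr : 0 < r) (t : ℝ) :
    circleLoop r t = Complex.exp (Real.log r + 2 * (Real.pi : ℂ) * Complex.I * t) := by
  rw [Complex.exp_add, ← Complex.ofReal_exp, Real.exp_log hr, circleLoop]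

theorem continuous_circleLoop (r : ℝ) : Continuous (circleLoop r) := by
  unfold circleLoop
  fun_prop

theorem circleLoop_mem_ball {r : ℝ} (hr : 0 < r) (hra : r < a) (t : ℝ) :
    circleLoop r t ∈ ball (0 : ℂ) a := by
  rw [circleLoop_eq_exp hr, exp_mem_ball_iff]
  simpa [Real.exp_log hr] using hra

theorem LogConnection.IsContinuation.continuous {γ : ℝ → ℂ} (hγ : Continuous γ) {s : ℝ → P.Total}
    (hs : N.IsContinuation γ s) : Continuous fun t : Set.Icc (0 : ℝ) 1 => toFlat N (s t) := by
  have h : ContinuousOn (fun t => toFlat N (s t)) (Set.Icc 0 1) := by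
    intro t ht
    obtain ⟨V, hV, hVD, hx, τ, hτ, hst⟩ := hs t ht
    have h1 : ContinuousAt (fun t => toFlat N (τ (γ t))) t :=
      ContinuousAt.comp (f := γ) (g := fun z => toFlat N (τ z))
        ((hτ.continuousOn hV hVD).continuousAt (hV.mem_nhds hx)) hγ.continuousAt
    exact h1.continuousWithinAt.congr_of_eventuallyEq hst (hst.self_of_nhdsWithin ht)
  exact continuousOn_iff_continuous_domRestrict.1 h

theorem LogConnection.IsContinuation.proj_eq {γ : ℝ → ℂ} {s : ℝ → P.Total}
    (hs : N.IsContinuation γ s) {t : ℝ} (ht : t ∈ Set.Icc (0 : ℝ) 1) :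
    P.proj (s t) = γ t ∧ γ t ∈ ball (0 : ℂ) a \ {0} := by
  obtain ⟨V, hV, hVD, hx, τ, hτ, hst⟩ := hs t ht
  exact ⟨by rw [hst.self_of_nhdsWithin ht, hτ.1 _ hx], hVD hx⟩

/-- Analytic continuation along a path is unique. -/
theorem LogConnection.IsMonodromy.unique (hG : IsAlgebraic G) {γ : ℝ → ℂ} (hγ : Continuous γ)
    {e : P.Total} {M M' : G} (h : N.IsMonodromy γ e M) (h' : N.IsMonodromy γ e M') : M = M' := by
  obtain ⟨s, hs, hs0, hs1⟩ := h
  obtain ⟨s', hs', hs0', hs1'⟩ := h'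
  have h := lift_unique hG (hs.continuous hγ) (hs'.continuous hγ) (a := ⟨0, by simp⟩)
    (fun t => (hs.proj_eq t.2).1.trans (hs'.proj_eq t.2).1.symm)
    (fun t => by
      change P.proj (s t) ∈ (ball (0 : ℂ) a \ {0} : Set ℂ)
      rw [(hs.proj_eq t.2).1]; exact (hs.proj_eq t.2).2) (hs0.trans hs0'.symm)
  have h1 : s 1 = s' 1 := congrFun h ⟨1, by simp⟩
  exact P.act_left_cancel (hs1.symm.trans (h1.trans hs1'))

theorem MultivaluedFlat.isMonodromy (hG : IsAlgebraic G) {F : ℂ → FlatTotal N} {M : G}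
    (hF : MultivaluedFlat N F M) {r : ℝ} (hr : 0 < r) (hra : r < a) :
    N.IsMonodromy (circleLoop r) (F (Real.log r : ℝ)) M := by
  have hmem (t : ℝ) : Complex.exp (Real.log r + 2 * (Real.pi : ℂ) * Complex.I * t) ∈
      ball (0 : ℂ) a := by
    rw [← circleLoop_eq_exp hr]; exact circleLoop_mem_ball hr hra t
  refine ⟨fun t => F (Real.log r + 2 * (Real.pi : ℂ) * Complex.I * t), fun t _ => ?_, ?_, ?_⟩
  · obtain ⟨V, hV, hVD, hx, τ, hτ, hFτ⟩ := hF.eventually_eq hG (hmem t)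
    refine ⟨V, hV, hVD, by rwa [circleLoop_eq_exp hr], τ, hτ, nhdsWithin_le_nhds ?_⟩
    have hc : Continuous fun t : ℝ => (Real.log r : ℂ) + 2 * (Real.pi : ℂ) * Complex.I * t := by
      fun_prop
    filter_upwards [hc.continuousAt.eventually hFτ] with t' ht'
    rw [ht', circleLoop_eq_exp hr]
  · change F (Real.log r + 2 * (Real.pi : ℂ) * Complex.I * (0 : ℝ)) = F (Real.log r : ℝ)
    rw [Complex.ofReal_zero, mul_zero, add_zero]
  · change F (Real.log r + 2 * (Real.pi : ℂ) * Complex.I * (1 : ℝ)) = P.act (F (Real.log r : ℝ)) M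
    rw [Complex.ofReal_one, mul_one]
    exact hF.period (Real.log r : ℝ) (by simpa using hmem 0)

/-- A multivalued flat section is given by a `LogFlat` frame with the same monodromy near the
singular point, in the local frame that is translated so that the connection form at `0` is the residue. -/
theorem MultivaluedFlat.exists_logFlat (hG : IsAlgebraic G) {F : ℂ → FlatTotal N} {M : G}
    (hF : MultivaluedFlat N F M) {e₀ : P.Total} {C : Mat n} (hC : N.HasResidue e₀ C) :
    ∃ ρ : ℝ, 0 < ρ ∧ ∃ v h : ℂ → Mat n, LogFlat G ρ v h (M : GL (Fin n) ℂ) ∧ v 0 = C := by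
  obtain ⟨i, hi, g, -, rfl⟩ := hC
  obtain ⟨ρ, hρ, hsub⟩ := Metric.isOpen_iff.1 (P.isOpen_dom i) 0 hi
  have hD {w : ℂ} (hw : Complex.exp w ∈ ball (0 : ℂ) ρ) : Complex.exp w ∈ ball (0 : ℂ) a :=
    P.dom_subset i (hsub hw)
  have hex (w : ℂ) : ∃ k : G, Complex.exp w ∈ ball (0 : ℂ) ρ →
      P.act (P.frame i (Complex.exp w)) k = F w := by
    by_cases hw : Complex.exp w ∈ ball (0 : ℂ) ρ
    · obtain ⟨k, hk, -⟩ := P.simply_transitive (P.frame i (Complex.exp w)) (F w)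
        ((P.proj_frame i _ (hsub hw)).trans (hF.proj w (hD hw)).symm)
      exact ⟨k, fun _ => hk⟩
    · exact ⟨1, fun h => absurd h hw⟩
  choose k hk using hex
  set B : Mat n := ((g : GL (Fin n) ℂ) : Mat n) with hB
  set B' : Mat n := (((g⁻¹ : G) : GL (Fin n) ℂ) : Mat n) with hB'
  have hBB' : B' * B = 1 := by simp [hB, hB']
  have hB'B : B * B' = 1 := by simp [hB, hB']
  -- the functions that describe `F` and the connection in the frame `σ_i g`
  refine ⟨ρ, hρ, fun z => B' * N.form i z * B, fun w => B' * mat k w, ⟨?_, ?_, ?_, ?_, ?_⟩, rfl⟩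
  · exact (((differentiableOn_matrix.2 (N.form_hol i)).mono hsub).const_mul B').mul_const B
  · exact fun z hz => conj_mem_lieAlg (coe_mem_matSet _) (coe_mem_matSet _) hBB'
      (N.form_mem i z (hsub hz))
  · intro w hw
    obtain ⟨V, hV, hVD, hx, τ, hτ, hFτ⟩ := hF.eventually_eq hG (hD hw)
    obtain ⟨κ, hκ, hflat⟩ := hτ.2 i
    have hopen : IsOpen (V ∩ P.dom i) := hV.inter (P.isOpen_dom i)
    have hxV : Complex.exp w ∈ V ∩ P.dom i := ⟨hx, hsub hw⟩
    have hkκ : ∀ᶠ w' in nhds w, k w' = κ (Complex.exp w') := by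
      filter_upwards [hFτ, Complex.continuous_exp.continuousAt.eventually (hopen.mem_nhds hxV),
        Complex.continuous_exp.continuousAt.eventually (Metric.isOpen_ball.mem_nhds hw)]
        with w' h1 h2 h3
      exact P.act_left_cancel ((hk w' h3).trans (h1.trans (hflat _ h2).1))
    have h1 := ((hκ.hasDerivAt hopen hxV).scomp w (Complex.hasDerivAt_exp w)).const_mul B'
    rw [eq_neg_of_add_eq_zero_left (hflat _ hxV).2] at h1
    have h2 : HasDerivAt (fun w => B' * mat k w) (B' * -(N.form i (Complex.exp w) *
        mat κ (Complex.exp w))) w := by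
      refine h1.congr_of_eventuallyEq ?_
      filter_upwards [hkκ] with w' h
      simp only [mat, h, Function.comp]
    have h3 : mat κ (Complex.exp w) = mat k w := by simp only [mat, hkκ.self_of_nhds]
    refine h2.congr_deriv ?_
    rw [h3, mul_neg, neg_mul, mul_assoc (B' * _) B, ← mul_assoc B B', hB'B, one_mul, mul_assoc]
  · exact fun w _ => mul_mem_matSet (coe_mem_matSet _) (coe_mem_matSet _)
  · intro w hw
    have h1 : k (w + 2 * (Real.pi : ℂ) * Complex.I) = k w * M := by
      have h2 := hk _ (exp_add_two_pi_I_mem_ball hw)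
      rw [Complex.exp_periodic w, hF.period w (hD hw), ← hk w hw, ← P.act_mul] at h2
      exact P.act_left_cancel h2
    simp only [mat, h1]
    rw [Subgroup.coe_mul, Units.val_mul, mul_assoc]

/-- A flat frame near the singular point has monodromy conjugate to `exp(-2πiC)`. -/
theorem LogFlat.isConj (hG : IsAlgebraic G) {C : Mat n} (hC : C ∈ lieAlg G)
    (hprep : WeaklyPrepared G C) {ρ : ℝ} (hρ : 0 < ρ) {v h : ℂ → Mat n} {M : G}
    (hL : LogFlat G ρ v h (M : GL (Fin n) ℂ)) (hv : v 0 = C) {T : G}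
    (hT : ((T : GL (Fin n) ℂ) : Mat n) = exp ((-(2 * (Real.pi : ℂ) * Complex.I)) • C)) :
    IsConj T M := by
  obtain ⟨k, hk⟩ := exists_nat_ge (2 * ‖C‖ + 2)
  obtain ⟨v', h', r, hL', hr, hv'⟩ := hL.exists_order hG hC hprep hρ hv k
  obtain ⟨K, ⟨K', hK', rfl⟩, hK⟩ := hL'.exists_conj_of_order hG hC hρ (k := k + 1)
    (by push_cast; linarith) hr hv'
  have h1 : ((K' * (M : GL (Fin n) ℂ) : GL (Fin n) ℂ) : Mat n) =
      ((T * K' : GL (Fin n) ℂ) : Mat n) := by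
    rw [Units.val_mul, Units.val_mul, hT]
    conv_rhs => rw [← hK]
    rw [← mul_assoc, ← mul_assoc, exp_neg_mul_exp_smul, one_mul]
  refine isConj_iff.2 ⟨⟨K', hK'⟩⁻¹, ?_⟩
  rw [inv_inv, mul_assoc, inv_mul_eq_iff_eq_mul]
  exact Subtype.ext (Units.ext h1).symm

theorem isNilpotent_sub_one_of_isConj {T M : G} (h : IsConj T M) :
    IsNilpotent (((T : GL (Fin n) ℂ) : Mat n) - 1) ↔
      IsNilpotent (((M : GL (Fin n) ℂ) : Mat n) - 1) := by
  obtain ⟨c, rfl⟩ := isConj_iff.1 h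
  rw [isNilpotent_sub_one_iff, isNilpotent_sub_one_iff]
  have h1 := spectrum.units_conjugate (R := ℂ) (a := ((T : GL (Fin n) ℂ) : Mat n))
    (u := (c : GL (Fin n) ℂ))
  rw [← h1]
  simp

end

end FlatGBundle

end

open FlatGBundle in
theorem theorem2p2 {n : ℕ} (G : Subgroup (Matrix.GeneralLinearGroup (Fin n) ℂ))
    (hG : FlatGBundle.IsAlgebraic G)
    (a : ℝ) (a₀ : ℝ) (ha₀ : 0 < a₀) (ha : a₀ < a)
    (P : FlatGBundle.PrincipalBundle.{u, v} G (Metric.ball (0 : ℂ) a))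
    (N : FlatGBundle.LogConnection P)
    -- a trivialization of the fibre over `0`, and the residue with respect to it
    (e₀ : P.Total) (he₀ : P.proj e₀ = 0)
    (C : Matrix (Fin n) (Fin n) ℂ) (hC : N.HasResidue e₀ C)
    (hprep : FlatGBundle.WeaklyPrepared G C)
    -- a trivialization of the fibre over the base point `a₀`
    (e₁ : P.Total) (he₁ : P.proj e₁ = (a₀ : ℂ)) :
    ∃ M : G,
      -- `M` is the local monodromy around `0`
      (∀ M' : G, N.IsMonodromy (FlatGBundle.circleLoop a₀) e₁ M' ↔ M' = M) ∧
      -- it is conjugate in `G` to `exp(-2πi C)`, which is an element of `G`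
      (∃ T : G, ((T : Matrix.GeneralLinearGroup (Fin n) ℂ) : Matrix (Fin n) (Fin n) ℂ)
          = NormedSpace.exp ((-(2 * (Real.pi : ℂ) * Complex.I)) • C) ∧ IsConj T M) ∧
      -- nilpotency of the residue against unipotency of the local monodromy
      ((FlatGBundle.Prepared G C ∨ FlatGBundle.NoCharacters G) →
        (IsNilpotent C ↔
          IsNilpotent (((M : Matrix.GeneralLinearGroup (Fin n) ℂ) :
            Matrix (Fin n) (Fin n) ℂ) - 1))) := by
  have hexp : Complex.exp (Real.log a₀ : ℝ) = a₀ := by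
    rw [← Complex.ofReal_exp, Real.exp_log ha₀]
  have hmem : Complex.exp (Real.log a₀ : ℝ) ∈ Metric.ball (0 : ℂ) a := by
    rw [exp_mem_ball_iff, Complex.ofReal_re, Real.exp_log ha₀]; exact ha
  obtain ⟨F, M, hF, hF₀⟩ := exists_multivaluedFlat (N := N) hG (ha₀.trans ha) hmem
    (he₁.trans hexp.symm)
  have hmono : N.IsMonodromy (circleLoop a₀) e₁ M := hF₀ ▸ hF.isMonodromy hG ha₀ ha
  obtain ⟨ρ, hρ, v, h, hL, hv⟩ := hF.exists_logFlat hG hC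
  have hCmem : C ∈ lieAlg G := hv ▸ hL.mem_lie 0 (Metric.mem_ball_self hρ)
  obtain ⟨T, hTG, hT⟩ := exp_mem_matSet hG hCmem (-(2 * (Real.pi : ℂ) * Complex.I))
  have hconj : IsConj (⟨T, hTG⟩ : G) M := hL.isConj hG hCmem hprep hρ hv hT
  refine ⟨M, fun M' => ⟨fun hM' => ?_, fun hM' => hM' ▸ hmono⟩, ⟨⟨T, hTG⟩, hT, hconj⟩, fun hP => ?_⟩
  · exact hM'.unique hG (continuous_circleLoop a₀) hmono
  · rw [isNilpotent_iff_exp hG hCmem hprep hP, ← isNilpotent_sub_one_of_isConj hconj, ← hT]
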